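/- Let $n\ge 1$ and $N\ge 0$ be integers, let $(f_K)_{K\ge 0}$ be any sequence of complex numbers, and let $p,q,b,a_1,\dots,a_n,x_1,\dots,x_n$ be complex numbers with $|p|<1$, with $q$, all $a_r$ and all $x_r$ nonzero, and with $b\neq 0$ (the value $b=0$ is also allowed when $p=0$). Write $$(a;p)_\infty=\prod_{j\ge 0}(1-ap^j),\qquad \theta(a;p)=(a;p)_\infty\,(p/a;p)_\infty,\qquad (a;q,p)_k=\prod_{j=0}^{k-1}\theta(aq^j;p)\quad(k\ge 0),$$ where, for $p=0$, $\theta(a;0)=1-a$ for every $a$, including $a=0$. For $k=(k_1,\dots,k_n)$ write $|k|=k_1+\dots+k_n$. Assume that no denominator below vanishes, that is: $\theta(x_r/x_s;p)\ne 0$ for $r<s$, and $(qx_r/x_s;q,p)_N$, $(bx_r;q,p)_N$, $(bx_r/a_r;q,p)_N$ are nonzero for all $1\le r,s\le n$. Then $$\sum_{\substack{k_1,\dots,k_n\ge 0\\ 0\le |k|\le N}}\Bigg(\prod_{1\le r<s\le n}\frac{\theta(q^{k_r-k_s}x_r/x_s;p)}{\theta(x_r/x_s;p)}\;\prod_{r,s=1}^n\frac{(a_sx_r/x_s;q,p)_{k_r}}{(qx_r/x_s;q,p)_{k_r}}\;\prod_{r=1}^n\frac{(bx_r/(a_1\cdots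 a_n);q,p)_{k_r}\,(bx_r;q,p)_{|k|}}{(bx_r;q,p)_{k_r}\,(bx_r/a_r;q,p)_{|k|}}\;q^{\sum_{r=1}^n(r-1)k_r}\,f_{|k|}\Bigg)=\sum_{K=0}^N\frac{(a_1\cdots a_n;q,p)_K}{(q;q,p)_K}\,f_K .$$ -/

import Mathlib

open scoped BigOperators

namespace EllipticSeries

/-- The infinite shifted factorial `(a; p)_∞ = ∏_{j ≥ 0} (1 - a p^j)` (convergent for `|p| < 1`). -/
noncomputable def shiftedInf (a p : ℂ) : ℂ :=
  ∏' j : ℕ, (1 - a * p ^ j)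

/-- The modified Jacobi theta function `θ(a; p) = (a; p)_∞ (p / a; p)_∞`
(meaningful for `|p| < 1` and `a ≠ 0`; for `p = 0` it is `1 - a`). -/
noncomputable def theta (a p : ℂ) : ℂ :=
  shiftedInf a p * shiftedInf (p / a) p

/-- The theta shifted factorial `(a; q, p)_k = ∏_{j=0}^{k-1} θ(a q^j; p)`. -/
noncomputable def thetaFac (a q p : ℂ) (k : ℕ) : ℂ :=
  ∏ j ∈ Finset.range k, theta (a * q ^ j) p

/-- The elliptic Vandermonde product of type `A`,
`∏_{r < s} θ(q^{k_r - k_s} x_r / x_s; p) / θ(x_r / x_s; p)`. -/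
noncomputable def ellipticVandermonde {n : ℕ} (q p : ℂ) (x : Fin n → ℂ) (k : Fin n → ℕ) : ℂ :=
  ∏ r : Fin n, ∏ s ∈ Finset.Ioi r,
    theta (q ^ ((k r : ℤ) - (k s : ℤ)) * (x r / x s)) p / theta (x r / x s) p

/-- The finite set of multi-indices `k = (k_1, …, k_n)` of non-negative integers with
`|k| = k_1 + ⋯ + k_n ≤ N`. -/
def multiIndicesLE (n N : ℕ) : Finset (Fin n → ℕ) :=
  (Fintype.piFinset fun _ : Fin n => Finset.range (N + 1)).filter fun k => ∑ r, k r ≤ N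

theorem mem_multiIndicesLE {n N : ℕ} {k : Fin n → ℕ} :
    k ∈ multiIndicesLE n N ↔ ∑ r, k r ≤ N := by
  simp only [multiIndicesLE, Finset.mem_filter, Fintype.mem_piFinset, Finset.mem_range,
    and_iff_right_iff_imp]
  intro h r
  have := Finset.single_le_sum (f := k) (fun i _ => Nat.zero_le _) (Finset.mem_univ r)
  omega

end EllipticSeries

namespace EllipticSeries

open Filter Topology

/-! Since `f` enters only through `|k|`, the sum splits into layers `|k| = K`, and it suffices that
each layer, without `f`, equals `(a_1⋯a_n; q, p)_K / (q; q, p)_K` (`sum_piAntidiag_eq`).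

Up to factors constant on a layer, this is the elliptic Jackson sum of type `A`
(`elliptic_jackson_sum`). The bridge is `ellipticVandermonde_mul_jacksonDenom`: the Vandermonde
quotient and the power of `q` turn the factors `(q x_r/x_s; q, p)_{k_r}` into the symmetric
denominator `∏ (q^{-k_s} x_r/x_s; q, p)_{k_r}`.

The Jackson sum is proved by induction on `K`. A theta partial fraction expands `θ(q^{-|k|})` as a
sum over `i` whose `i`-th term vanishes when `k_i = 0`. When `k_i > 0`, it turns the summand into
one for `K - 1` with `k_i` lowered by one, `z_i` replaced by `q z_i` and `b` by `bq`; this preserves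
the balancing condition. The induction hypothesis evaluates the inner sums, and a second partial
fraction collapses the sum over `i`.

The partial fractions follow by induction on the number of nodes from the Weierstrass addition
formula `theta_three_term`. That formula is a Plücker relation: by Jacobi's triple product, `θ(xy)
θ(x/y) / x` is a 2×2 determinant in functions of `x` and of `y`.

Auxiliary nonvanishing conditions are removed by continuity, as they fail only on countable sets of
a parameter. -/

/-! ### Theta functions as infinite products: continuity, inversion, zeros. -/

theorem summable_norm_mul_pow {p : ℂ} (hp : ‖p‖ < 1) (a : ℂ) :
    Summable fun j : ℕ => ‖-(a * p ^ j)‖ := by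
  simp only [norm_neg, norm_mul, norm_pow]
  exact (summable_geometric_of_lt_one (norm_nonneg _) hp).mul_left _

theorem multipliable_one_sub_mul_pow {p : ℂ} (hp : ‖p‖ < 1) (a : ℂ) :
    Multipliable fun j : ℕ => 1 - a * p ^ j := by
  simpa [sub_eq_add_neg] using multipliable_one_add_of_summable (summable_norm_mul_pow hp a)

theorem tendsto_shiftedInf {p : ℂ} (hp : ‖p‖ < 1) (a : ℂ) :
    Tendsto (fun m : ℕ => ∏ j ∈ Finset.range m, (1 - a * p ^ j)) atTop (𝓝 (shiftedInf a p)) :=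
  (multipliable_one_sub_mul_pow hp a).hasProd.tendsto_prod_nat

theorem shiftedInf_eq_mul {p : ℂ} (hp : ‖p‖ < 1) (a : ℂ) :
    shiftedInf a p = (1 - a) * shiftedInf (a * p) p := by
  have h : (fun j : ℕ => 1 - a * p ^ (j + 1)) = fun j : ℕ => 1 - a * p * p ^ j := by
    funext j; ring
  unfold shiftedInf
  rw [tprod_eq_zero_mul' (f := fun j : ℕ => 1 - a * p ^ j)
    (by rw [h]; exact multipliable_one_sub_mul_pow hp _), h]
  simp

theorem exists_mul_pow_eq_one_of_shiftedInf_eq_zero {p : ℂ} (hp : ‖p‖ < 1) {a : ℂ}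
    (h : shiftedInf a p = 0) : ∃ j : ℕ, a * p ^ j = 1 := by
  by_contra! hne
  refine tprod_one_add_ne_zero_of_summable (f := fun j : ℕ => -(a * p ^ j)) (fun j => ?_)
    (summable_norm_mul_pow hp a) ?_
  · rw [← sub_eq_add_neg, sub_ne_zero]
    exact (hne j).symm
  · simpa [shiftedInf, sub_eq_add_neg] using h

theorem continuous_shiftedInf {p : ℂ} (hp : ‖p‖ < 1) : Continuous fun a => shiftedInf a p := by
  rw [continuous_iff_continuousAt]
  intro a
  have := tendsto_tprod_one_add_of_dominated_convergence (𝓕 := 𝓝 a)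
    (f := fun (c : ℂ) (j : ℕ) => -(c * p ^ j)) (g := fun j : ℕ => -(a * p ^ j))
    (bound := fun j : ℕ => (‖a‖ + 1) * ‖p‖ ^ j)
    ((summable_geometric_of_lt_one (norm_nonneg _) hp).mul_left _)
    (fun k => (continuous_id.mul continuous_const).neg.tendsto a)
    (by
      filter_upwards [Metric.ball_mem_nhds a one_pos] with c hc j
      rw [norm_neg, norm_mul, norm_pow]
      gcongr
      rw [mem_ball_iff_norm] at hc
      calc ‖c‖ = ‖a + (c - a)‖ := by ring_nf
        _ ≤ ‖a‖ + ‖c - a‖ := norm_add_le _ _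
        _ ≤ ‖a‖ + 1 := by linarith)
  simpa only [ContinuousAt, shiftedInf, sub_eq_add_neg] using this

theorem shiftedInf_zero_left (p : ℂ) : shiftedInf 0 p = 1 := by
  simp [shiftedInf]

theorem shiftedInf_zero_right (a : ℂ) : shiftedInf a 0 = 1 - a := by
  rw [shiftedInf_eq_mul (by simp) a, mul_zero, shiftedInf_zero_left, mul_one]

theorem theta_zero_right (a : ℂ) : theta a 0 = 1 - a := by
  simp [theta, shiftedInf_zero_right]

/-- For `p = 0` the function is the polynomial `1 - a`, so `a = 0` is harmless; this is how the
value `b = 0` is reached when `p = 0`. -/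
theorem continuousAt_theta {p : ℂ} (hp : ‖p‖ < 1) {a : ℂ} (ha : p ≠ 0 → a ≠ 0) :
    ContinuousAt (fun a => theta a p) a := by
  by_cases h0 : p = 0
  · subst h0
    simp only [theta_zero_right]
    fun_prop
  · exact (continuous_shiftedInf hp).continuousAt.mul
      ((continuous_shiftedInf hp).continuousAt.comp (continuousAt_const.div continuousAt_id (ha h0)))

theorem theta_inv {p : ℂ} (hp : ‖p‖ < 1) {a : ℂ} (ha : a ≠ 0) :
    theta a⁻¹ p = -(a⁻¹) * theta a p := by
  have h1 := shiftedInf_eq_mul hp a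
  have h2 := shiftedInf_eq_mul hp a⁻¹
  unfold theta
  rw [h2, h1, show p / a = a⁻¹ * p by ring, show p / a⁻¹ = a * p by field_simp]
  field_simp
  ring

theorem theta_div_swap {p : ℂ} (hp : ‖p‖ < 1) {a b : ℂ} (ha : a ≠ 0) (hb : b ≠ 0) :
    theta (a / b) p = -(a / b) * theta (b / a) p := by
  have := theta_inv hp (div_ne_zero hb ha)
  rwa [inv_div] at this

theorem theta_one (p : ℂ) (hp : ‖p‖ < 1) : theta 1 p = 0 := by
  unfold theta
  rw [shiftedInf_eq_mul hp]
  simp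

/-- Makes the exceptional parameter sets in both continuity arguments countable, hence with dense
complement. -/
theorem countable_theta_zeros {p : ℂ} (hp : ‖p‖ < 1) :
    {a : ℂ | theta a p = 0}.Countable := by
  refine ((Set.countable_range fun j : ℕ => (p ^ j)⁻¹).union
    ((Set.countable_range fun j : ℕ => p * p ^ j).union (Set.countable_singleton 0))).mono ?_
  intro a ha
  rcases mul_eq_zero.1 ha with h | h
  · obtain ⟨j, hj⟩ := exists_mul_pow_eq_one_of_shiftedInf_eq_zero hp h
    exact Or.inl ⟨j, (eq_inv_of_mul_eq_one_left hj).symm⟩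
  · obtain ⟨j, hj⟩ := exists_mul_pow_eq_one_of_shiftedInf_eq_zero hp h
    by_cases ha0 : a = 0
    · exact Or.inr (Or.inr ha0)
    · refine Or.inr (Or.inl ⟨j, ?_⟩)
      field_simp at hj
      exact hj

/-- Two functions continuous at a point that agree off a countable set agree at the point. -/
theorem eq_of_eqOn_compl_countable {F G : ℂ → ℂ} {s : ℂ} {S : Set ℂ} (hS : S.Countable)
    (hF : ContinuousAt F s) (hG : ContinuousAt G s) (h : ∀ c, c ∉ S → F c = G c) :
    F s = G s := by
  have hd : Dense Sᶜ := hS.dense_compl ℝ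
  have : (𝓝[Sᶜ] s).NeBot := mem_closure_iff_nhdsWithin_neBot.1 (hd s)
  refine tendsto_nhds_unique_of_eventuallyEq (hF.tendsto.mono_left (nhdsWithin_le_nhds (s := Sᶜ)))
    (hG.tendsto.mono_left nhdsWithin_le_nhds) ?_
  filter_upwards [self_mem_nhdsWithin] with c hc using h c hc

/-! ### The finite q-binomial theorem and Jacobi's triple product. -/

/-- The Gaussian binomial coefficient with base `p`. -/
def gaussBinom (p : ℂ) : ℕ → ℕ → ℂ
  | _, 0 => 1
  | 0, _ + 1 => 0
  | M + 1, k + 1 => p ^ (k + 1) * gaussBinom p M (k + 1) + gaussBinom p M k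

theorem gaussBinom_zero_right (p : ℂ) (M : ℕ) : gaussBinom p M 0 = 1 := by
  cases M <;> rfl

theorem gaussBinom_eq_zero (p : ℂ) : ∀ {M k : ℕ}, M < k → gaussBinom p M k = 0
  | _, 0, h => absurd h (Nat.not_lt_zero _)
  | 0, _ + 1, _ => rfl
  | M + 1, k + 1, h => by
    rw [gaussBinom, gaussBinom_eq_zero p (by omega), gaussBinom_eq_zero p (by omega)]
    simp

theorem gaussBinom_self (p : ℂ) : ∀ M : ℕ, gaussBinom p M M = 1
  | 0 => rfl
  | M + 1 => by rw [gaussBinom, gaussBinom_eq_zero p (by omega), gaussBinom_self p M]; simp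

/-- The finite product `(p; p)_k`. -/
def eulerProd (p : ℂ) (k : ℕ) : ℂ := ∏ j ∈ Finset.range k, (1 - p * p ^ j)

theorem eulerProd_succ (p : ℂ) (k : ℕ) :
    eulerProd p (k + 1) = eulerProd p k * (1 - p * p ^ k) := Finset.prod_range_succ _ _

theorem gaussBinom_mul_eulerProd (p : ℂ) : ∀ k l : ℕ,
    gaussBinom p (k + l) k * eulerProd p k * eulerProd p l = eulerProd p (k + l)
  | 0, l => by simp [gaussBinom_zero_right, eulerProd]
  | k + 1, 0 => by simp [gaussBinom_self, eulerProd]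
  | k + 1, l + 1 => by
    have h1 := gaussBinom_mul_eulerProd p (k + 1) l
    have h2 := gaussBinom_mul_eulerProd p k (l + 1)
    rw [show k + 1 + (l + 1) = (k + 1 + l) + 1 by ring, gaussBinom]
    rw [show k + (l + 1) = k + 1 + l by ring] at h2
    rw [eulerProd_succ p (k + 1 + l)]
    rw [eulerProd_succ p l] at *
    rw [eulerProd_succ p k] at *
    linear_combination p ^ (k + 1) * (1 - p * p ^ l) * h1 + (1 - p * p ^ k) * h2

/-- The q-binomial theorem. Splitting off the factor `1 + z` leaves the same product at `z p`, and
comparing coefficients gives the Pascal rule that defines `gaussBinom`. -/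
theorem prod_one_add_mul_pow (p : ℂ) (M : ℕ) : ∀ z : ℂ,
    ∏ j ∈ Finset.range M, (1 + z * p ^ j)
      = ∑ k ∈ Finset.range (M + 1), gaussBinom p M k * p ^ (k.choose 2) * z ^ k := by
  induction M with
  | zero => intro z; simp [gaussBinom_zero_right]
  | succ M ih =>
    intro z
    have h : ∏ j ∈ Finset.range (M + 1), (1 + z * p ^ j)
        = (1 + z) * ∏ j ∈ Finset.range M, (1 + z * p * p ^ j) := by
      rw [Finset.prod_range_succ', mul_comm]
      simp only [pow_zero, mul_one]
      congr 1
      exact Finset.prod_congr rfl fun j _ => by ring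
    have h2 : ∑ k ∈ Finset.range (M + 1), gaussBinom p M k * p ^ (k.choose 2) * (z * p) ^ k
        = 1 + ∑ k ∈ Finset.range (M + 1),
            gaussBinom p M (k + 1) * p ^ ((k + 1).choose 2) * (z * p) ^ (k + 1) := by
      have := Finset.sum_range_succ' (fun k => gaussBinom p M k * p ^ (k.choose 2) * (z * p) ^ k)
        (M + 1)
      rw [Finset.sum_range_succ, gaussBinom_eq_zero p (Nat.lt_succ_self M)] at this
      simp only [gaussBinom_zero_right, show Nat.choose 0 2 = 0 from rfl, pow_zero] at this
      linear_combination this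
    rw [h, ih, add_mul, one_mul, Finset.sum_range_succ' _ (M + 1)]
    nth_rw 1 [h2]
    rw [Finset.mul_sum, add_assoc, ← Finset.sum_add_distrib, add_comm]
    congr 1
    · refine Finset.sum_congr rfl fun k _ => ?_
      rw [gaussBinom, Nat.choose_succ_succ' k 1, Nat.choose_one_right]
      ring
    · simp [gaussBinom_zero_right]

/-- The general term `(-z)^n p^{n(n-1)/2}` of the theta series. -/
noncomputable def thetaTerm (p z : ℂ) (n : ℤ) : ℂ := (-z) ^ n * p ^ (n * (n - 1) / 2)

theorem thetaTerm_succ {p z : ℂ} (hp : p ≠ 0) (hz : z ≠ 0) (n : ℤ) :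
    thetaTerm p z (n + 1) = -z * p ^ n * thetaTerm p z n := by
  unfold thetaTerm
  rw [show (n + 1) * (n + 1 - 1) = n * (n - 1) + n * 2 by ring,
    Int.add_mul_ediv_right _ _ two_ne_zero, zpow_add₀ hp, zpow_add_one₀ (neg_ne_zero.2 hz)]
  ring

theorem thetaTerm_zero (p z : ℂ) : thetaTerm p z 0 = 1 := by simp [thetaTerm]

theorem thetaTerm_ne_zero {p z : ℂ} (hp : p ≠ 0) (hz : z ≠ 0) (n : ℤ) : thetaTerm p z n ≠ 0 :=
  mul_ne_zero (zpow_ne_zero _ (neg_ne_zero.2 hz)) (zpow_ne_zero _ hp)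

theorem summable_thetaTerm {p z : ℂ} (hp : p ≠ 0) (hp1 : ‖p‖ < 1) (hz : z ≠ 0) :
    Summable (thetaTerm p z) := by
  have hpow := tendsto_pow_atTop_nhds_zero_of_lt_one (norm_nonneg p) hp1
  refine Summable.of_nat_of_neg ?_ ?_
  · refine summable_of_ratio_test_tendsto_lt_one one_pos
      (Eventually.of_forall fun n => thetaTerm_ne_zero hp hz _) ?_
    have : (fun n : ℕ => ‖thetaTerm p z ((n + 1 : ℕ) : ℤ)‖ / ‖thetaTerm p z (n : ℤ)‖)
        = fun n => ‖z‖ * ‖p‖ ^ n := by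
      funext n
      push_cast
      rw [thetaTerm_succ hp hz, norm_mul, mul_div_assoc,
        div_self (norm_ne_zero_iff.2 (thetaTerm_ne_zero hp hz _))]
      simp
    rw [this]
    simpa using hpow.const_mul ‖z‖
  · refine summable_of_ratio_test_tendsto_lt_one one_pos
      (Eventually.of_forall fun n => thetaTerm_ne_zero hp hz _) ?_
    have : (fun n : ℕ => ‖thetaTerm p z (-((n + 1 : ℕ) : ℤ))‖ / ‖thetaTerm p z (-(n : ℤ))‖)
        = fun n => ‖z‖⁻¹ * ‖p‖ * ‖p‖ ^ n := by
      funext n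
      have h := thetaTerm_succ hp hz (-((n + 1 : ℕ) : ℤ))
      rw [show -((n + 1 : ℕ) : ℤ) + 1 = -(n : ℤ) by push_cast; ring] at h
      have h0 := norm_ne_zero_iff.2 (thetaTerm_ne_zero hp hz (-((n + 1 : ℕ) : ℤ)))
      rw [h, norm_mul, norm_mul, norm_neg, norm_zpow, zpow_neg, zpow_natCast, pow_succ]
      have := norm_ne_zero_iff.2 hp
      have := norm_ne_zero_iff.2 hz
      field_simp
    rw [this]
    simpa using hpow.const_mul (‖z‖⁻¹ * ‖p‖)

/-- This is the q-binomial theorem with `2m` factors at `-z p^{-m}`: the last `m` factors give the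
product in `z`, and the first `m`, reversed, give the product in `p/z` up to a monomial. -/
theorem finite_triple_product {p z : ℂ} (hp : p ≠ 0) (hz : z ≠ 0) (m : ℕ) :
    (∏ j ∈ Finset.range m, (1 - z * p ^ j)) * ∏ j ∈ Finset.range m, (1 - p / z * p ^ j)
      = ∑ k ∈ Finset.range (2 * m + 1), gaussBinom p (2 * m) k * thetaTerm p z (k - m) := by
  have h1 : ∏ j ∈ Finset.range m, (1 + -z * p ^ (-(m : ℤ)) * p ^ j)
      = (thetaTerm p z (-m))⁻¹ * ∏ j ∈ Finset.range m, (1 - p / z * p ^ j) := by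
    have hrefl : ∏ j ∈ Finset.range m, (1 + -z * p ^ (-(m : ℤ)) * p ^ j)
        = ∏ j ∈ Finset.range m, (1 - z / (p * p ^ j)) := by
      rw [← Finset.prod_range_reflect]
      refine Finset.prod_congr rfl fun j hj => ?_
      have hj := Finset.mem_range.1 hj
      have : p ^ m = p ^ (m - 1 - j) * (p * p ^ j) := by
        rw [← pow_succ', ← pow_add]; congr 1; omega
      rw [zpow_neg, zpow_natCast, this]
      field_simp
      ring
    rw [hrefl]
    clear hrefl
    induction m with
    | zero => simp [thetaTerm_zero]
    | succ m ih =>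
      rw [Finset.prod_range_succ, ih, Finset.prod_range_succ]
      have h := thetaTerm_succ hp hz (-((m + 1 : ℕ) : ℤ))
      rw [show -((m + 1 : ℕ) : ℤ) + 1 = -(m : ℤ) by push_cast; ring] at h
      have h0 := thetaTerm_ne_zero hp hz (-((m + 1 : ℕ) : ℤ))
      rw [h, zpow_neg, zpow_natCast, pow_succ]
      field_simp
      ring
  have h2 := prod_one_add_mul_pow p (2 * m) (-z * p ^ (-(m : ℤ)))
  rw [two_mul, Finset.prod_range_add, h1] at h2
  have h3 : ∏ j ∈ Finset.range m, (1 + -z * p ^ (-(m : ℤ)) * p ^ (m + j))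
      = ∏ j ∈ Finset.range m, (1 - z * p ^ j) := by
    refine Finset.prod_congr rfl fun j _ => ?_
    rw [zpow_neg, zpow_natCast, pow_add]
    field_simp
    ring
  rw [h3] at h2
  have h0 := thetaTerm_ne_zero hp hz (-m)
  have h4 : ∀ k : ℕ, thetaTerm p z (k - m)
      = thetaTerm p z (-m) * (p ^ (k.choose 2) * (-z * p ^ (-(m : ℤ))) ^ k) := by
    intro k
    induction k with
    | zero => simp
    | succ k ih =>
      rw [show ((k + 1 : ℕ) : ℤ) - m = (k - m) + 1 by push_cast; ring, thetaTerm_succ hp hz, ih,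
        Nat.choose_succ_succ' k 1, Nat.choose_one_right, zpow_sub₀ hp, zpow_neg, zpow_natCast,
        zpow_natCast]
      ring
  simp only [h4, ← two_mul] at h2 ⊢
  calc _ = thetaTerm p z (-m) * ((thetaTerm p z (-m))⁻¹
          * (∏ j ∈ Finset.range m, (1 - p / z * p ^ j))
          * ∏ j ∈ Finset.range m, (1 - z * p ^ j)) := by field_simp
    _ = _ := by
      rw [h2, Finset.mul_sum]
      exact Finset.sum_congr rfl fun k _ => by ring

theorem tendsto_eulerProd {p : ℂ} (hp : ‖p‖ < 1) :
    Tendsto (eulerProd p) atTop (𝓝 (shiftedInf p p)) := tendsto_shiftedInf hp p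

theorem one_sub_mul_pow_ne_zero {p : ℂ} (hp : ‖p‖ < 1) (j : ℕ) : 1 - p * p ^ j ≠ 0 := by
  intro h
  have h1 : ‖p ^ (j + 1)‖ < 1 := by
    rw [norm_pow]; exact pow_lt_one₀ (norm_nonneg _) hp (Nat.succ_ne_zero j)
  rw [pow_succ', ← sub_eq_zero.1 h, norm_one] at h1
  exact lt_irrefl _ h1

theorem eulerProd_ne_zero {p : ℂ} (hp : ‖p‖ < 1) (k : ℕ) : eulerProd p k ≠ 0 :=
  Finset.prod_ne_zero_iff.2 fun j _ => one_sub_mul_pow_ne_zero hp j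

theorem shiftedInf_self_ne_zero {p : ℂ} (hp : ‖p‖ < 1) : shiftedInf p p ≠ 0 := by
  intro h
  obtain ⟨j, hj⟩ := exists_mul_pow_eq_one_of_shiftedInf_eq_zero hp h
  exact one_sub_mul_pow_ne_zero hp j (by rw [hj, sub_self])

theorem gaussBinom_eq_div {p : ℂ} (hp : ‖p‖ < 1) {M k l : ℕ} (h : k + l = M) :
    gaussBinom p M k = eulerProd p M / (eulerProd p k * eulerProd p l) := by
  subst h
  rw [eq_div_iff (mul_ne_zero (eulerProd_ne_zero hp _) (eulerProd_ne_zero hp _)), ← mul_assoc,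
    gaussBinom_mul_eulerProd]

/-- The products `(p; p)_k` converge to a nonzero limit, so they and their inverses are bounded. The
bound supplies the dominating series for the limit in the triple product. -/
theorem exists_gaussBinom_bound {p : ℂ} (hp : ‖p‖ < 1) : ∃ K, ∀ M k, ‖gaussBinom p M k‖ ≤ K := by
  obtain ⟨A, hA⟩ := (tendsto_eulerProd hp).norm.bddAbove_range
  obtain ⟨B, hB⟩ := ((tendsto_eulerProd hp).inv₀ (shiftedInf_self_ne_zero hp)).norm.bddAbove_range
  have hA' : ∀ k, ‖eulerProd p k‖ ≤ A := fun k => hA ⟨k, rfl⟩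
  have hB' : ∀ k, ‖(eulerProd p k)⁻¹‖ ≤ B := fun k => hB ⟨k, rfl⟩
  have hA0 : 0 ≤ A := (norm_nonneg _).trans (hA' 0)
  have hB0 : 0 ≤ B := (norm_nonneg _).trans (hB' 0)
  refine ⟨A * (B * B), fun M k => ?_⟩
  rcases lt_or_ge M k with h | h
  · rw [gaussBinom_eq_zero p h, norm_zero]
    positivity
  · rw [gaussBinom_eq_div hp (Nat.add_sub_of_le h), div_eq_mul_inv, mul_inv, norm_mul, norm_mul]
    exact mul_le_mul (hA' _) (mul_le_mul (hB' _) (hB' _) (norm_nonneg _) hB0) (by positivity) hA0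

/-- The Jacobi triple product identity. -/
theorem triple_product {p z : ℂ} (hp : p ≠ 0) (hp1 : ‖p‖ < 1) (hz : z ≠ 0) :
    shiftedInf p p * theta z p = ∑' n, thetaTerm p z n := by
  obtain ⟨K, hK⟩ := exists_gaussBinom_bound hp1
  have hP := shiftedInf_self_ne_zero hp1
  -- Only the lower cut-off is needed: for `n > m` the binomial vanishes, but for `n < -m`
  -- truncation by `toNat` would produce the value `1`.
  let f : ℕ → ℤ → ℂ := fun m n =>
    if -(m : ℤ) ≤ n then gaussBinom p (2 * m) (m + n).toNat * thetaTerm p z n else 0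
  have hsum : ∀ m, (∏ j ∈ Finset.range m, (1 - z * p ^ j))
      * ∏ j ∈ Finset.range m, (1 - p / z * p ^ j) = ∑' n, f m n := by
    intro m
    rw [finite_triple_product hp hz, tsum_eq_sum
      (s := (Finset.range (2 * m + 1)).image fun k : ℕ => (k : ℤ) - m), Finset.sum_image]
    · refine Finset.sum_congr rfl fun k _ => ?_
      simp [f]
    · intro a _ b _ h
      simpa using h
    · intro n hn
      simp only [f]
      split_ifs with h
      · rw [gaussBinom_eq_zero, zero_mul]
        by_contra hlt
        refine hn (Finset.mem_image.2 ⟨(m + n).toNat, Finset.mem_range.2 (by omega), by omega⟩)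
      · rfl
  have hlim : Tendsto (fun m => ∑' n, f m n) atTop
      (𝓝 (∑' n, (shiftedInf p p)⁻¹ * thetaTerm p z n)) := by
    refine tendsto_tsum_of_dominated_convergence (bound := fun n => K * ‖thetaTerm p z n‖)
      ((summable_thetaTerm hp hp1 hz).norm.mul_left K) (fun n => ?_)
      (Eventually.of_forall fun m n => ?_)
    -- The central binomials `gaussBinom p (2m) (m + n)` tend to `1 / (p; p)_∞` for each fixed `n`.
    · have hg : Tendsto (fun m : ℕ => eulerProd p (2 * m)
          / (eulerProd p (m + n).toNat * eulerProd p (m - n).toNat)) atTop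
          (𝓝 (shiftedInf p p / (shiftedInf p p * shiftedInf p p))) := by
        have hT := tendsto_eulerProd hp1
        refine (hT.comp ?_).div ((hT.comp ?_).mul (hT.comp ?_)) (mul_ne_zero hP hP)
        all_goals
          rw [tendsto_atTop]
          intro b
          filter_upwards [eventually_ge_atTop (b + n.natAbs)] with m hm
          omega
      have he : shiftedInf p p / (shiftedInf p p * shiftedInf p p) = (shiftedInf p p)⁻¹ := by
        field_simp
      rw [he] at hg
      refine (hg.mul_const (thetaTerm p z n)).congr' ?_
      filter_upwards [eventually_ge_atTop n.natAbs] with m hm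
      simp only [f]
      rw [if_pos (by omega), gaussBinom_eq_div hp1 (k := (m + n).toNat) (l := (m - n).toNat)
        (by omega)]
    · simp only [f]
      split_ifs
      · rw [norm_mul]
        exact mul_le_mul_of_nonneg_right (hK _ _) (norm_nonneg _)
      · rw [norm_zero]
        exact mul_nonneg ((norm_nonneg _).trans (hK 0 0)) (norm_nonneg _)
  have hlim2 := (tendsto_shiftedInf hp1 z).mul (tendsto_shiftedInf hp1 (p / z))
  simp only [hsum] at hlim2
  have := tendsto_nhds_unique hlim2 hlim
  rw [tsum_mul_left] at this
  rw [theta, this, mul_inv_cancel_left₀ hP]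

/-! ### The Weierstrass addition formula. -/

/-- The decomposition of pairs of integers by the parity of their sum. -/
noncomputable def parityEquiv : (ℤ × ℤ) ⊕ (ℤ × ℤ) ≃ ℤ × ℤ :=
  Equiv.ofBijective
    (Sum.elim (fun u => (u.1 + u.2, u.1 - u.2)) (fun u => (u.1 + u.2 + 1, u.1 - u.2))) (by
      constructor
      · rintro (⟨a, b⟩ | ⟨a, b⟩) (⟨c, d⟩ | ⟨c, d⟩) h <;> simp at h ⊢ <;> omega
      · rintro ⟨m, n⟩
        rcases Int.even_or_odd (m + n) with ⟨k, hk⟩ | ⟨k, hk⟩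
        · exact ⟨Sum.inl (k, k - n), by simp; omega⟩
        · exact ⟨Sum.inr (k, k - n), by simp; omega⟩)

/-- The indices `i + j` and `i - j` diagonalise the quadratic exponent, so the product separates
into a function of `i` times one of `j`. Writing it with `i - 1` shows the same odd-power series in
`x` that the odd case has in `y`. -/
theorem thetaTerm_mul_even {p x y : ℂ} (hp : p ≠ 0) (hx : x ≠ 0) (hy : y ≠ 0) (i j : ℤ) :
    thetaTerm p (x * y) (i + j) * thetaTerm p (x / y) (i - j)
      = (x * (p ^ ((i - 1) ^ 2 + (i - 1)) * x ^ (2 * (i - 1) + 1)))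
        * (p ^ (j ^ 2) * y ^ (2 * j)) := by
  have he : (i + j) * (i + j - 1) / 2 + (i - j) * (i - j - 1) / 2
      = (i - 1) ^ 2 + (i - 1) + j ^ 2 := by
    have h1 : (2 : ℤ) ∣ (i - j) * (i - j - 1) := by
      rw [mul_comm]; exact even_iff_two_dvd.1 (by simpa using Int.even_mul_succ_self (i - j - 1))
    rw [← Int.add_ediv_of_dvd_right h1]
    refine Int.ediv_eq_of_eq_mul_left two_ne_zero ?_
    ring
  have hs : (-1 : ℂ) ^ (i + j) * (-1) ^ (i - j) = 1 := by
    rw [← zpow_add₀ (by norm_num), show i + j + (i - j) = 2 * i by ring, zpow_mul]; norm_num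
  unfold thetaTerm
  rw [show -(x * y) = -1 * (x * y) by ring, show -(x / y) = -1 * (x / y) by ring, mul_zpow,
    mul_zpow, mul_zpow, div_zpow]
  have hx' : x * x ^ (2 * (i - 1) + 1) = x ^ (i + j) * x ^ (i - j) := by
    rw [← zpow_one_add₀ hx, ← zpow_add₀ hx]; congr 1; ring
  have hy' : y ^ (2 * j) = y ^ (i + j) / y ^ (i - j) := by
    rw [← zpow_sub₀ hy]; congr 1; ring
  have hp' : p ^ ((i + j) * (i + j - 1) / 2) * p ^ ((i - j) * (i - j - 1) / 2)
      = p ^ ((i - 1) ^ 2 + (i - 1)) * p ^ (j ^ 2) := by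
    rw [← zpow_add₀ hp, ← zpow_add₀ hp, he]
  calc _ = ((-1 : ℂ) ^ (i + j) * (-1) ^ (i - j)) * (x ^ (i + j) * x ^ (i - j))
        * (y ^ (i + j) / y ^ (i - j))
        * (p ^ ((i + j) * (i + j - 1) / 2) * p ^ ((i - j) * (i - j - 1) / 2)) := by ring
    _ = _ := by rw [hs, ← hx', ← hy', hp']; ring

theorem thetaTerm_mul_odd {p x y : ℂ} (hp : p ≠ 0) (hx : x ≠ 0) (hy : y ≠ 0) (i j : ℤ) :
    thetaTerm p (x * y) (i + j + 1) * thetaTerm p (x / y) (i - j)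
      = -(x * (p ^ (i ^ 2) * x ^ (2 * i))) * (p ^ (j ^ 2 + j) * y ^ (2 * j + 1)) := by
  have he : (i + j + 1) * (i + j + 1 - 1) / 2 + (i - j) * (i - j - 1) / 2
      = i ^ 2 + (j ^ 2 + j) := by
    have h1 : (2 : ℤ) ∣ (i - j) * (i - j - 1) := by
      rw [mul_comm]; exact even_iff_two_dvd.1 (by simpa using Int.even_mul_succ_self (i - j - 1))
    rw [← Int.add_ediv_of_dvd_right h1]
    refine Int.ediv_eq_of_eq_mul_left two_ne_zero ?_
    ring
  have hs : (-1 : ℂ) ^ (i + j + 1) * (-1) ^ (i - j) = -1 := by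
    rw [← zpow_add₀ (by norm_num), show i + j + 1 + (i - j) = 2 * i + 1 by ring,
      zpow_add_one₀ (by norm_num), zpow_mul]; norm_num
  unfold thetaTerm
  rw [show -(x * y) = -1 * (x * y) by ring, show -(x / y) = -1 * (x / y) by ring, mul_zpow,
    mul_zpow, mul_zpow, div_zpow]
  have hx' : x * x ^ (2 * i) = x ^ (i + j + 1) * x ^ (i - j) := by
    rw [← zpow_one_add₀ hx, ← zpow_add₀ hx]; congr 1; ring
  have hy' : y ^ (2 * j + 1) = y ^ (i + j + 1) / y ^ (i - j) := by
    rw [← zpow_sub₀ hy]; congr 1; ring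
  have hp' : p ^ ((i + j + 1) * (i + j + 1 - 1) / 2) * p ^ ((i - j) * (i - j - 1) / 2)
      = p ^ (i ^ 2) * p ^ (j ^ 2 + j) := by
    rw [← zpow_add₀ hp, ← zpow_add₀ hp, he]
  calc _ = ((-1 : ℂ) ^ (i + j + 1) * (-1) ^ (i - j)) * (x ^ (i + j + 1) * x ^ (i - j))
        * (y ^ (i + j + 1) / y ^ (i - j))
        * (p ^ ((i + j + 1) * (i + j + 1 - 1) / 2) * p ^ ((i - j) * (i - j - 1) / 2)) := by ring
    _ = _ := by rw [hs, ← hx', ← hy', hp']; ring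

theorem tsum_mul_tsum_of_summable_mul {f g : ℤ → ℂ} (h : Summable fun u : ℤ × ℤ => f u.1 * g u.2) :
    ∑' u : ℤ × ℤ, f u.1 * g u.2 = (∑' i, f i) * ∑' j, g j := by
  rw [h.tsum_prod]
  simp only [tsum_mul_left, tsum_mul_right]

/-- `θ(xy) θ(x/y)` is an alternating form of rank two in `x` and `y`. -/
theorem exists_theta_mul_theta {p : ℂ} (hp1 : ‖p‖ < 1) : ∃ B D : ℂ → ℂ, ∀ x y : ℂ,
    x ≠ 0 → y ≠ 0 → theta (x * y) p * theta (x / y) p = x * (D x * B y - B x * D y) := by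
  by_cases hp : p = 0
  · subst hp
    refine ⟨fun _ => 1, fun x => x + x⁻¹, fun x y hx hy => ?_⟩
    simp only [theta_zero_right]
    field_simp
    ring
  · have hP := shiftedInf_self_ne_zero hp1
    -- The even and odd powers of `y` give the two basis functions. Each carries one factor `1 / (p;
    -- p)_∞`, cancelling the square that arises from multiplying two triple products.
    refine ⟨fun y => (shiftedInf p p)⁻¹ * ∑' j : ℤ, p ^ (j ^ 2) * y ^ (2 * j),
      fun y => (shiftedInf p p)⁻¹ * ∑' j : ℤ, p ^ (j ^ 2 + j) * y ^ (2 * j + 1),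
      fun x y hx hy => ?_⟩
    have h1 := triple_product hp hp1 (mul_ne_zero hx hy)
    have h2 := triple_product hp hp1 (div_ne_zero hx hy)
    have s1 := (summable_thetaTerm hp hp1 (mul_ne_zero hx hy)).norm
    have s2 := (summable_thetaTerm hp hp1 (div_ne_zero hx hy)).norm
    have hs : Summable fun u : ℤ × ℤ => thetaTerm p (x * y) u.1 * thetaTerm p (x / y) u.2 :=
      summable_mul_of_summable_norm s1 s2
    have h3 : (shiftedInf p p * theta (x * y) p) * (shiftedInf p p * theta (x / y) p)
        = ∑' u : ℤ × ℤ, thetaTerm p (x * y) u.1 * thetaTerm p (x / y) u.2 := by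
      rw [h1, h2, tsum_mul_tsum_of_summable_norm s1 s2]
    have hs' := parityEquiv.summable_iff.2 hs
    have hl := hs'.comp_injective Sum.inl_injective
    have hr := hs'.comp_injective Sum.inr_injective
    replace h3 := h3.trans ((parityEquiv.tsum_eq _).symm.trans (Summable.tsum_sum hl hr))
    let f₁ : ℤ → ℂ := fun i => x * (p ^ ((i - 1) ^ 2 + (i - 1)) * x ^ (2 * (i - 1) + 1))
    let g₁ : ℤ → ℂ := fun j => p ^ (j ^ 2) * y ^ (2 * j)
    let f₂ : ℤ → ℂ := fun i => -(x * (p ^ (i ^ 2) * x ^ (2 * i)))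
    let g₂ : ℤ → ℂ := fun j => p ^ (j ^ 2 + j) * y ^ (2 * j + 1)
    have el := fun u : ℤ × ℤ => thetaTerm_mul_even hp hx hy u.1 u.2
    have er := fun u : ℤ × ℤ => thetaTerm_mul_odd hp hx hy u.1 u.2
    have t₁ := (tsum_congr el).trans
      (tsum_mul_tsum_of_summable_mul (f := f₁) (g := g₁) (hl.congr fun u => el u))
    have t₂ := (tsum_congr er).trans
      (tsum_mul_tsum_of_summable_mul (f := f₂) (g := g₂) (hr.congr fun u => er u))
    replace h3 := h3.trans (congrArg₂ (· + ·) t₁ t₂)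
    have u₁ : ∑' i, f₁ i = x * ∑' i : ℤ, p ^ (i ^ 2 + i) * x ^ (2 * i + 1) := by
      simp only [f₁]
      rw [tsum_mul_left]
      exact congrArg _ ((Equiv.subRight (1 : ℤ)).tsum_eq
        (fun i => p ^ (i ^ 2 + i) * x ^ (2 * i + 1)))
    have u₂ : ∑' i, f₂ i = -(x * ∑' i : ℤ, p ^ (i ^ 2) * x ^ (2 * i)) := by
      simp only [f₂]
      rw [tsum_neg, tsum_mul_left]
    rw [u₁, u₂] at h3
    simp only [g₁, g₂] at h3
    field_simp
    linear_combination h3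

/-- The Plücker relation among the 2×2 minors formed from `(B, D)` at four points `X, Y, U, V`,
where each theta pair is one minor up to a monomial. -/
theorem theta_three_term {p : ℂ} (hp : ‖p‖ < 1) {t a b c x : ℂ} (ht : t ≠ 0) (ha : a ≠ 0)
    (hb : b ≠ 0) (hc : c ≠ 0) (hx : x ≠ 0) :
    theta (t * c / b) p * theta (x * t / a) p * theta (x / b) p * theta (a / c) p
      = theta t p * theta (a / b) p * theta (x * (t * c / b) / a) p * theta (x / c) p
        - (a / c) * (theta (c * t / a) p * theta (c / b) p * theta (x * t / b) p
          * theta (x / a) p) := by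
  obtain ⟨B, D, h⟩ := exists_theta_mul_theta hp
  -- The points must satisfy `XV = t` and `X/V = a/b`, which forces `X² = ta/b`; then `Y`, `U`, `V`
  -- are determined by the other arguments.
  obtain ⟨X, hX⟩ := IsAlgClosed.exists_pow_nat_eq (t * a / b) (n := 2) two_pos
  have hX0 : X ≠ 0 := by
    rintro rfl
    have : t * a / b ≠ 0 := by positivity
    exact this (by rw [← hX]; simp)
  have hbX : b * X ^ 2 = t * a := by rw [hX]; field_simp
  set Y := t * c / (b * X) with hY
  set V := t / X with hV
  set U := x * t / (b * X) with hU
  have hY0 : Y ≠ 0 := by positivity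
  have hV0 : V ≠ 0 := by positivity
  have hU0 : U ≠ 0 := by positivity
  have e1 := h X Y hX0 hY0
  have e2 := h U V hU0 hV0
  have e3 := h X V hX0 hV0
  have e4 := h U Y hU0 hY0
  have e5 := h Y V hY0 hV0
  have e6 := h X U hX0 hU0
  have r1 : X * Y = t * c / b := by rw [hY]; field_simp
  have r2 : X / Y = a / c := by rw [hY]; field_simp; linear_combination hbX
  have r3 : U * V = x * t / a := by rw [hU, hV]; field_simp; linear_combination (-1 : ℂ) * hbX
  have r4 : U / V = x / b := by rw [hU, hV]; field_simp
  have r5 : X * V = t := by rw [hV]; field_simp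
  have r6 : X / V = a / b := by rw [hV]; field_simp; linear_combination hbX
  have r7 : U * Y = x * (t * c / b) / a := by
    rw [hU, hY]; field_simp; linear_combination (-1 : ℂ) * hbX
  have r8 : U / Y = x / c := by rw [hU, hY]; field_simp
  have r9 : Y * V = c * t / a := by rw [hY, hV]; field_simp; linear_combination (-1 : ℂ) * hbX
  have r10 : Y / V = c / b := by rw [hY, hV]; field_simp
  have r11 : X * U = x * t / b := by rw [hU]; field_simp
  have r12 : X / U = a / x := by rw [hU]; field_simp; linear_combination hbX
  have hs := theta_div_swap hp hx ha
  rw [r1, r2] at e1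
  rw [r3, r4] at e2
  rw [r5, r6] at e3
  rw [r7, r8] at e4
  rw [r9, r10] at e5
  rw [r11, r12] at e6
  rw [hs]
  have hm : a / c * -(x / a) = -(x / c) := by field_simp
  have hm' : x / c * Y = U := by rw [← r8]; field_simp
  linear_combination (theta (x * t / a) p * theta (x / b) p) * e1
    + X * (D X * B Y - B X * D Y) * e2
    - (theta (x * (t * c / b) / a) p * theta (x / c) p) * e3 - X * (D X * B V - B X * D V) * e4
    + (hm * (theta (c * t / a) p * theta (c / b) p * theta (x * t / b) p * theta (a / x) p))
    - (x / c) * (theta (x * t / b) p * theta (a / x) p) * e5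
    - (x / c) * (Y * (D Y * B V - B Y * D V)) * e6
    - hm' * (D Y * B V - B Y * D V) * X * (D X * B U - B X * D U)

theorem theta_three_term_div {p : ℂ} (hp : ‖p‖ < 1) {t a b c x : ℂ} (ht : t ≠ 0) (ha : a ≠ 0)
    (hb : b ≠ 0) (hc : c ≠ 0) (hx : x ≠ 0) (hac : theta (a / c) p ≠ 0) (hxa : theta (x / a) p ≠ 0)
    (hxc : theta (x / c) p ≠ 0) :
    theta (t * (c / b)) p * (theta (x * t / a) p / theta (x / a) p)
        * (theta (x / b) p / theta (x / c) p)
      = theta t p * (theta (a / b) p / theta (a / c) p)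
          * (theta (x * (t * (c / b)) / a) p / theta (x / a) p)
        + theta (c * t / a) p / theta (c / a) p * theta (c / b) p
          * (theta (x * (t * (c / b)) / c) p / theta (x / c) p) := by
  have h := theta_three_term hp ht ha hb hc hx
  have hs := theta_div_swap hp hc ha
  have hca : theta (c / a) p ≠ 0 := by
    rw [hs]
    exact mul_ne_zero (neg_ne_zero.2 (div_ne_zero hc ha)) hac
  rw [show x * (t * (c / b)) / c = x * t / b by field_simp, hs,
    show t * (c / b) = t * c / b by ring]
  have : theta (c * t / a) p / (-(c / a) * theta (a / c) p)
      = -(a / c) * theta (c * t / a) p / theta (a / c) p := by field_simp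
  rw [this]
  generalize theta (t * c / b) p = T1 at *
  generalize theta (x * (t * c / b) / a) p = T2 at *
  field_simp at h ⊢
  linear_combination h

/-! ### Partial fractions for theta quotients. -/

/-- Partial fraction expansion of a quotient of theta functions. -/
theorem theta_partial_fraction {ι : Type*} [DecidableEq ι] {p : ℂ} (hp : ‖p‖ < 1) {a : ι → ℂ}
    (ha : ∀ i, a i ≠ 0) (s : Finset ι) :
    (∀ i ∈ s, ∀ j ∈ s, i ≠ j → theta (a i / a j) p ≠ 0) →
    ∀ b : ι → ℂ, (∀ i, b i ≠ 0) → ∀ x : ℂ, x ≠ 0 → (∀ i ∈ s, theta (x / a i) p ≠ 0) →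
    theta (∏ j ∈ s, a j / b j) p * ∏ j ∈ s, theta (x / b j) p / theta (x / a j) p
      = ∑ k ∈ s, (∏ j ∈ s, theta (a k / b j) p) / (∏ j ∈ s.erase k, theta (a k / a j) p)
        * (theta (x * (∏ j ∈ s, a j / b j) / a k) p / theta (x / a k) p) := by
  induction s using Finset.induction_on with
  | empty => intro _ b _ x _ _; simp [theta_one p hp]
  | insert m s hm ih =>
    intro hne b hb x hx hxa
    -- With no previous nodes the factor `θ(∏ a_j/b_j)` is `θ(1) = 0` and cannot be made nonzero by
    -- perturbation, so a single node is handled directly.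
    rcases s.eq_empty_or_nonempty with rfl | ⟨m₀, hm₀⟩
    · simp only [insert_empty_eq, Finset.prod_singleton, Finset.sum_singleton,
        Finset.erase_singleton, Finset.prod_empty, div_one]
      rw [show x * (a m / b m) / a m = x / b m by have := ha m; field_simp]
    have hne' : ∀ i ∈ s, ∀ j ∈ s, i ≠ j → theta (a i / a j) p ≠ 0 := fun i hi j hj =>
      hne i (Finset.mem_insert_of_mem hi) j (Finset.mem_insert_of_mem hj)
    have hxs : ∀ i ∈ s, theta (x / a i) p ≠ 0 := fun i hi => hxa i (Finset.mem_insert_of_mem hi)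
    have hxm := hxa m (Finset.mem_insert_self m s)
    have hms : ∀ k ∈ s, k ≠ m := fun k hk h => hm (h ▸ hk)
    have hmk : ∀ k ∈ s, theta (a m / a k) p ≠ 0 := fun k hk =>
      hne m (Finset.mem_insert_self m s) k (Finset.mem_insert_of_mem hk) (hms k hk).symm
    have hkm : ∀ k ∈ s, theta (a k / a m) p ≠ 0 := fun k hk =>
      hne k (Finset.mem_insert_of_mem hk) m (Finset.mem_insert_self m s) (hms k hk)
    -- Generic case, where one may cancel `θ(t)` with `t` the product over the old nodes. After
    -- expanding at `x`, the three-term relation splits each term in two: one part is the new term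
    -- at the old node, and the other parts add up, by the expansion at `x = a m`, to the term at
    -- the new node.
    have key : ∀ b : ι → ℂ, (∀ i, b i ≠ 0) → theta (∏ j ∈ s, a j / b j) p ≠ 0 →
        theta (∏ j ∈ insert m s, a j / b j) p
            * ∏ j ∈ insert m s, theta (x / b j) p / theta (x / a j) p
          = ∑ k ∈ insert m s, (∏ j ∈ insert m s, theta (a k / b j) p)
              / (∏ j ∈ (insert m s).erase k, theta (a k / a j) p)
            * (theta (x * (∏ j ∈ insert m s, a j / b j) / a k) p / theta (x / a k) p) := by
      intro b hb ht
      have ht0 : ∏ j ∈ s, a j / b j ≠ 0 :=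
        Finset.prod_ne_zero_iff.2 fun j _ => div_ne_zero (ha j) (hb j)
      have i1 := ih hne' b hb x hx hxs
      have i2 := ih hne' b hb (a m) (ha m) hmk
      rw [Finset.sum_insert hm, Finset.erase_insert hm]
      have hsum : ∑ k ∈ s, (∏ j ∈ insert m s, theta (a k / b j) p)
              / (∏ j ∈ (insert m s).erase k, theta (a k / a j) p)
            * (theta (x * (∏ j ∈ insert m s, a j / b j) / a k) p / theta (x / a k) p)
          = ∑ k ∈ s, (∏ j ∈ s, theta (a k / b j) p) / (∏ j ∈ s.erase k, theta (a k / a j) p)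
            * (theta (a k / b m) p / theta (a k / a m) p)
            * (theta (x * (∏ j ∈ insert m s, a j / b j) / a k) p / theta (x / a k) p) := by
        refine Finset.sum_congr rfl fun k hk => ?_
        rw [Finset.erase_insert_of_ne (hms k hk).symm, Finset.prod_insert hm,
          Finset.prod_insert (fun h => hm (Finset.mem_of_mem_erase h))]
        ring
      rw [hsum, Finset.prod_insert hm, Finset.prod_insert hm, Finset.prod_insert hm]
      generalize ht_def : ∏ j ∈ s, a j / b j = t at *
      rw [Finset.prod_div_distrib] at i2
      have hPm : ∏ j ∈ s, theta (a m / a j) p ≠ 0 := Finset.prod_ne_zero_iff.2 hmk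
      refine mul_left_cancel₀ ht ?_
      rw [mul_comm (a m / b m) t]
      calc theta t p * (theta (t * (a m / b m)) p * (theta (x / b m) p / theta (x / a m) p
              * ∏ j ∈ s, theta (x / b j) p / theta (x / a j) p))
          = theta (t * (a m / b m)) p * (theta (x / b m) p / theta (x / a m) p)
              * (theta t p * ∏ j ∈ s, theta (x / b j) p / theta (x / a j) p) := by ring
        _ = ∑ k ∈ s, (∏ j ∈ s, theta (a k / b j) p) / (∏ j ∈ s.erase k, theta (a k / a j) p)
              * (theta (t * (a m / b m)) p * (theta (x * t / a k) p / theta (x / a k) p)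
                * (theta (x / b m) p / theta (x / a m) p)) := by
            rw [i1, Finset.mul_sum]
            exact Finset.sum_congr rfl fun k _ => by ring
        _ = ∑ k ∈ s, (theta t p * ((∏ j ∈ s, theta (a k / b j) p)
                / (∏ j ∈ s.erase k, theta (a k / a j) p)
                * (theta (a k / b m) p / theta (a k / a m) p)
                * (theta (x * (t * (a m / b m)) / a k) p / theta (x / a k) p))
              + (∏ j ∈ s, theta (a k / b j) p) / (∏ j ∈ s.erase k, theta (a k / a j) p)
                * (theta (a m * t / a k) p / theta (a m / a k) p)
                * (theta (a m / b m) p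
                  * (theta (x * (t * (a m / b m)) / a m) p / theta (x / a m) p))) := by
            refine Finset.sum_congr rfl fun k hk => ?_
            rw [theta_three_term_div hp ht0 (ha k) (hb m) (ha m) hx (hkm k hk) (hxs k hk) hxm]
            ring
        _ = _ := by
            rw [Finset.sum_add_distrib, ← Finset.mul_sum, ← Finset.sum_mul, ← i2]
            ring
    -- Dividing one `b m₀` by `σ` multiplies the product over the old nodes by `σ`, so the generic
    -- case applies off a countable set of `σ`; continuity at `σ = 1` gives the rest.
    let B : ℂ → ι → ℂ := fun σ => Function.update b m₀ (b m₀ / σ)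
    have hB1 : B 1 = b := by simp [B]
    have hBc : ContinuousAt B 1 :=
      continuousAt_const.update m₀ (continuousAt_const.div continuousAt_id one_ne_zero)
    have hBj : ∀ j, ContinuousAt (fun σ => B σ j) 1 := fun j => (continuousAt_pi.1 hBc) j
    have hth : ∀ f : ℂ → ℂ, ContinuousAt f 1 → f 1 ≠ 0 →
        ContinuousAt (fun σ => theta (f σ) p) 1 := fun f hf h0 =>
      ContinuousAt.comp (g := fun a => theta a p) (continuousAt_theta hp fun _ => h0) hf
    have hquot : ∀ (c : ℂ) (j : ι), c ≠ 0 → ContinuousAt (fun σ => theta (c / B σ j) p) 1 :=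
      fun c j hc => hth _ (continuousAt_const.div (hBj j) (by rw [hB1]; exact hb j))
        (by rw [hB1]; exact div_ne_zero hc (hb j))
    have hprod : ContinuousAt (fun σ => ∏ j ∈ insert m s, a j / B σ j) 1 :=
      tendsto_finsetProd _ fun j _ =>
        continuousAt_const.div (hBj j) (by rw [hB1]; exact hb j)
    have hprod0 : ∏ j ∈ insert m s, a j / B 1 j ≠ 0 := by
      rw [hB1]
      exact Finset.prod_ne_zero_iff.2 fun j _ => div_ne_zero (ha j) (hb j)
    have ht0 : ∏ j ∈ s, a j / b j ≠ 0 :=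
      Finset.prod_ne_zero_iff.2 fun j _ => div_ne_zero (ha j) (hb j)
    have hcount : ({0} ∪ (fun σ => (∏ j ∈ s, a j / b j) * σ) ⁻¹' {a | theta a p = 0}).Countable :=
      (Set.countable_singleton 0).union
        ((countable_theta_zeros hp).preimage (mul_right_injective₀ ht0))
    have := eq_of_eqOn_compl_countable (s := 1)
      (F := fun σ => theta (∏ j ∈ insert m s, a j / B σ j) p
            * ∏ j ∈ insert m s, theta (x / B σ j) p / theta (x / a j) p)
      (G := fun σ => ∑ k ∈ insert m s, (∏ j ∈ insert m s, theta (a k / B σ j) p)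
              / (∏ j ∈ (insert m s).erase k, theta (a k / a j) p)
            * (theta (x * (∏ j ∈ insert m s, a j / B σ j) / a k) p / theta (x / a k) p)) hcount
      ((hth _ hprod hprod0).mul (tendsto_finsetProd _ fun j _ => (hquot x j hx).div_const _))
      (tendsto_finsetSum _ fun k _ =>
        ((tendsto_finsetProd _ fun j _ => hquot _ j (ha k)).div_const _).mul
          ((hth _ ((continuousAt_const.mul hprod).div_const _)
            (div_ne_zero (mul_ne_zero hx hprod0) (ha k))).div_const _))
      (fun σ hσ => by
        simp only [Set.mem_union, Set.mem_singleton_iff, Set.mem_preimage, Set.mem_ofPred_eq,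
          not_or] at hσ
        refine key (B σ) (fun i => ?_) ?_
        · by_cases hi : i = m₀
          · subst hi
            simpa [B] using ⟨hb i, hσ.1⟩
          · simpa [B, hi] using hb i
        · have : ∏ j ∈ s, a j / B σ j = (∏ j ∈ s, a j / b j) * σ := by
            rw [← Finset.mul_prod_erase _ _ hm₀, ← Finset.mul_prod_erase _ _ hm₀,
              Finset.prod_congr (g := fun j => a j / b j) rfl fun j hj => by
                simp [B, Finset.ne_of_mem_erase hj]]
            simp only [B, Function.update_self]
            have := hσ.1
            have := hb m₀
            field_simp
          rw [this]
          exact hσ.2)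
    simpa only [hB1] using this

/-- The partial fraction expansion with the pole at `1 / β` and all theta functions inverted. -/
theorem theta_partial_fraction_inv {ι : Type*} [DecidableEq ι] {p : ℂ} (hp : ‖p‖ < 1)
    {a b : ι → ℂ} (ha : ∀ i, a i ≠ 0) (hb : ∀ i, b i ≠ 0) (s : Finset ι)
    (hne : ∀ i ∈ s, ∀ j ∈ s, i ≠ j → theta (a i / a j) p ≠ 0) {β : ℂ} (hβ : β ≠ 0)
    (hβa : ∀ i ∈ s, theta (β * a i) p ≠ 0) :
    theta (∏ j ∈ s, a j / b j) p * ∏ j ∈ s, theta (β * b j) p / theta (β * a j) p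
      = ∑ k ∈ s, (∏ j ∈ s, theta (a k / b j) p) / (∏ j ∈ s.erase k, theta (a k / a j) p)
        * (theta (β * a k / ∏ j ∈ s, a j / b j) p / theta (β * a k) p) := by
  have hinv : ∀ c : ℂ, c ≠ 0 → theta (β⁻¹ / c) p = -(β⁻¹ / c) * theta (β * c) p := fun c hc => by
    have := theta_inv hp (mul_ne_zero hβ hc)
    rwa [mul_inv, ← div_eq_mul_inv] at this
  have h := theta_partial_fraction hp ha s hne b hb β⁻¹ (inv_ne_zero hβ) fun i hi => by
    rw [hinv _ (ha i)]
    exact mul_ne_zero (neg_ne_zero.2 (div_ne_zero (inv_ne_zero hβ) (ha i))) (hβa i hi)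
  have ht0 : ∏ j ∈ s, a j / b j ≠ 0 :=
    Finset.prod_ne_zero_iff.2 fun j _ => div_ne_zero (ha j) (hb j)
  have h1 : ∏ j ∈ s, theta (β⁻¹ / b j) p / theta (β⁻¹ / a j) p
      = (∏ j ∈ s, a j / b j) * ∏ j ∈ s, theta (β * b j) p / theta (β * a j) p := by
    rw [← Finset.prod_mul_distrib]
    refine Finset.prod_congr rfl fun j hj => ?_
    rw [hinv _ (ha j), hinv _ (hb j)]
    have := hβa j hj
    have := ha j
    have := hb j
    field_simp
  refine mul_left_cancel₀ ht0 ?_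
  rw [mul_left_comm, ← h1, h, Finset.mul_sum]
  refine Finset.sum_congr rfl fun k hk => ?_
  have hk0 := ha k
  have := theta_inv hp (a := β * a k / ∏ j ∈ s, a j / b j)
    (div_ne_zero (mul_ne_zero hβ hk0) ht0)
  rw [hinv _ hk0, show β⁻¹ * (∏ j ∈ s, a j / b j) / a k = (β * a k / ∏ j ∈ s, a j / b j)⁻¹ by
    field_simp, this]
  generalize ∏ j ∈ s, a j / b j = t at *
  have := hβa k hk
  field_simp

/-! ### Theta shifted factorials and the elliptic Jackson sum of type `A`. -/

theorem thetaFac_zero (a q p : ℂ) : thetaFac a q p 0 = 1 := by simp [thetaFac]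

theorem thetaFac_succ (a q p : ℂ) (k : ℕ) :
    thetaFac a q p (k + 1) = thetaFac a q p k * theta (a * q ^ k) p :=
  Finset.prod_range_succ _ _

theorem thetaFac_succ' (a q p : ℂ) (k : ℕ) :
    thetaFac a q p (k + 1) = theta a p * thetaFac (a * q) q p k := by
  unfold thetaFac
  rw [Finset.prod_range_succ', mul_comm, pow_zero, mul_one]
  congr 1
  exact Finset.prod_congr rfl fun j _ => by rw [pow_succ', mul_assoc]

variable {ι : Type*} [Fintype ι]

/-- The symmetric denominator `∏_{r,s} (q^{-k_s} z_r / z_s; q, p)_{k_r}`. -/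
noncomputable def jacksonDenom (q p : ℂ) (z : ι → ℂ) (k : ι → ℕ) : ℂ :=
  ∏ r, ∏ s, thetaFac (q ^ (-(k s : ℤ)) * (z r / z s)) q p (k r)

/-- The row product `∏_r (c z_r; q, p)_{k_r}`. -/
noncomputable def rowFac (q p c : ℂ) (z : ι → ℂ) (k : ι → ℕ) : ℂ :=
  ∏ r, thetaFac (c * z r) q p (k r)

/-- The summand of the elliptic Jackson sum of type `A`. -/
noncomputable def jacksonTerm (q p : ℂ) (α : ι → ℂ) (d b : ℂ) (z : ι → ℂ) (k : ι → ℕ) : ℂ :=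
  (∏ j, rowFac q p (α j) z k) * rowFac q p d z k / (jacksonDenom q p z k * rowFac q p b z k)

theorem rowFac_mul_prod_theta (q p b : ℂ) (z : ι → ℂ) (k : ι → ℕ) :
    rowFac q p b z k * ∏ r, theta (b * z r * q ^ k r) p
      = (∏ r, theta (b * z r) p) * rowFac q p (b * q) z k := by
  unfold rowFac
  rw [← Finset.prod_mul_distrib, ← Finset.prod_mul_distrib]
  refine Finset.prod_congr rfl fun r _ => ?_
  rw [← thetaFac_succ, thetaFac_succ', mul_right_comm]

/-- No denominator of the elliptic Jackson sum over `|k| = K` vanishes. -/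
def NonResonant {ι : Type*} (q p : ℂ) (z : ι → ℂ) (K : ℕ) : Prop :=
  ∀ r s, ∀ j : ℤ, -(K : ℤ) ≤ j → j ≤ K → (r = s → j ≠ 0) → theta (q ^ j * (z r / z s)) p ≠ 0

variable [DecidableEq ι]

/-- Replacing `z i` by `z i * q` moves the exponent by at most one, which the loss from `K + 1` to
`K` absorbs. -/
theorem NonResonant.shift {ι : Type*} [DecidableEq ι] {q p : ℂ} {z : ι → ℂ} {K : ℕ} (hq : q ≠ 0) (hz : ∀ r, z r ≠ 0)
    (h : NonResonant q p z (K + 1)) (i : ι) :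
    NonResonant q p (Function.update z i (z i * q)) K := by
  intro r s j h1 h2 h3
  have hi := hz i
  by_cases hr : r = i <;> by_cases hs : s = i
  · subst hr; subst hs
    have := h s s j (by push_cast; omega) (by push_cast; omega) h3
    rw [Function.update_self, div_self (mul_ne_zero hi hq)]
    rwa [div_self hi] at this
  · subst hr
    have := h r s (j + 1) (by push_cast; omega) (by push_cast; omega) fun e => absurd e.symm hs
    rw [Function.update_self, Function.update_of_ne hs]
    rwa [zpow_add_one₀ hq, show q ^ j * q * (z r / z s) = q ^ j * (z r * q / z s) by ring] at this
  · subst hs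
    have := h r s (j - 1) (by push_cast; omega) (by push_cast; omega) fun e => absurd e hr
    rw [Function.update_self, Function.update_of_ne hr]
    rwa [zpow_sub_one₀ hq, show q ^ j * q⁻¹ * (z r / z s) = q ^ j * (z r / (z s * q)) by
      field_simp] at this
  · have := h r s j (by push_cast; omega) (by push_cast; omega) h3
    rwa [Function.update_of_ne hs, Function.update_of_ne hr]

/-- The index `s` enters only through `q^{k_s} z_s`, which changes alike under `k_i ↦ k_i + 1` and
`z_i ↦ q z_i`. Hence rows other than `i` agree, and row `i` differs by its first factors. -/
theorem jacksonDenom_update {q p : ℂ} (hq : q ≠ 0) {z : ι → ℂ} (hz : ∀ r, z r ≠ 0) (m : ι → ℕ)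
    (i : ι) :
    jacksonDenom q p z (Function.update m i (m i + 1))
      = jacksonDenom q p (Function.update z i (z i * q)) m
        * ∏ s, theta (q ^ (-(Function.update m i (m i + 1) s : ℤ)) * (z i / z s)) p := by
  have hi := hz i
  unfold jacksonDenom
  rw [← Finset.mul_prod_erase _ _ (Finset.mem_univ i),
    ← Finset.mul_prod_erase _ (fun r => ∏ s, thetaFac (q ^ (-(m s : ℤ)) * _) q p (m r))
      (Finset.mem_univ i), mul_right_comm, ← Finset.prod_mul_distrib]
  congr 1
  · refine Finset.prod_congr rfl fun s _ => ?_
    rw [Function.update_self, Function.update_self, thetaFac_succ', mul_comm]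
    congr 2
    by_cases hs : s = i
    · subst hs
      rw [Function.update_self, Function.update_self, div_self hi, div_self (mul_ne_zero hi hq)]
      push_cast
      rw [neg_add, zpow_add₀ hq, zpow_neg_one]
      field_simp
    · rw [Function.update_of_ne hs, Function.update_of_ne hs]
      ring
  · refine Finset.prod_congr rfl fun r hr => Finset.prod_congr rfl fun s _ => ?_
    have hr := Finset.ne_of_mem_erase hr
    rw [Function.update_of_ne hr, Function.update_of_ne hr]
    congr 1
    by_cases hs : s = i
    · subst hs
      rw [Function.update_self, Function.update_self]
      push_cast
      rw [neg_add, zpow_add₀ hq, zpow_neg_one]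
      field_simp
    · rw [Function.update_of_ne hs, Function.update_of_ne hs]

theorem rowFac_update (q p c : ℂ) (z : ι → ℂ) (m : ι → ℕ) (i : ι) :
    rowFac q p c z (Function.update m i (m i + 1))
      = rowFac q p c (Function.update z i (z i * q)) m * theta (c * z i) p := by
  unfold rowFac
  rw [← Finset.mul_prod_erase _ _ (Finset.mem_univ i),
    ← Finset.mul_prod_erase _ (fun r => thetaFac (c * _) q p (m r)) (Finset.mem_univ i),
    mul_right_comm]
  congr 1
  · rw [Function.update_self, Function.update_self, thetaFac_succ', mul_comm, mul_assoc]
  · refine Finset.prod_congr rfl fun r hr => ?_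
    have hr := Finset.ne_of_mem_erase hr
    rw [Function.update_of_ne hr, Function.update_of_ne hr]

theorem rowFac_const_update (q p c : ℂ) (z : ι → ℂ) (K : ℕ) (i : ι) :
    rowFac q p c (Function.update z i (z i * q)) (fun _ => K) * theta (c * z i) p
      = rowFac q p c z (fun _ => K) * theta (c * z i * q ^ K) p := by
  rw [← rowFac_update q p c z (fun _ => K) i]
  unfold rowFac
  rw [← Finset.mul_prod_erase _ _ (Finset.mem_univ i),
    ← Finset.mul_prod_erase _ (fun r => thetaFac (c * z r) q p K) (Finset.mem_univ i),
    mul_right_comm, ← thetaFac_succ, Function.update_self]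
  congr 1
  refine Finset.prod_congr rfl fun r hr => ?_
  rw [Function.update_of_ne (Finset.ne_of_mem_erase hr)]

theorem sum_piAntidiag_succ {K : ℕ} (i : ι) (g : (ι → ℕ) → ℂ) (hg : ∀ k, k i = 0 → g k = 0) :
    ∑ k ∈ Finset.piAntidiag Finset.univ (K + 1), g k
      = ∑ m ∈ Finset.piAntidiag Finset.univ K, g (Function.update m i (m i + 1)) := by
  symm
  refine Finset.sum_of_injOn (fun m => Function.update m i (m i + 1)) ?_ ?_ ?_ (fun _ _ => rfl)
  · intro m _ m' _ h
    funext j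
    have hj := congrFun h j
    by_cases hji : j = i
    · subst hji; simpa using hj
    · simpa [hji] using hj
  · intro m hm
    simp only [Finset.mem_coe, Finset.mem_piAntidiag, Finset.mem_univ, implies_true, and_true]
      at hm ⊢
    rw [Finset.sum_update_of_mem (Finset.mem_univ i)]
    rw [← Finset.add_sum_erase _ _ (Finset.mem_univ i)] at hm
    rw [Finset.sdiff_singleton_eq_erase]
    omega
  · intro k hk hk'
    refine hg k ?_
    by_contra h0
    refine hk' ⟨Function.update k i (k i - 1), ?_, ?_⟩
    · simp only [Finset.mem_coe, Finset.mem_piAntidiag, Finset.mem_univ, implies_true, and_true]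
        at hk ⊢
      rw [Finset.sum_update_of_mem (Finset.mem_univ i), Finset.sdiff_singleton_eq_erase]
      rw [← Finset.add_sum_erase _ _ (Finset.mem_univ i)] at hk
      omega
    · funext j
      by_cases hji : j = i
      · subst hji
        simp only [Function.update_self]
        omega
      · simp [hji]

theorem NonResonant.ne_zero_of_ne {ι : Type*} {q p : ℂ} {z : ι → ℂ} {K : ℕ} (h : NonResonant q p z K) {r s : ι}
    (hrs : r ≠ s) : theta (z r / z s) p ≠ 0 := by
  simpa using h r s 0 (by omega) (by omega) fun e => absurd e hrs

theorem NonResonant.theta_neg_ne_zero {ι : Type*} {q p : ℂ} {z : ι → ℂ} {K : ℕ} (hz : ∀ r, z r ≠ 0)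
    (h : NonResonant q p z (K + 1)) (i : ι) : theta (q ^ (-((K + 1 : ℕ) : ℤ))) p ≠ 0 := by
  have := h i i (-((K + 1 : ℕ) : ℤ)) le_rfl (by omega) fun _ => by omega
  rwa [div_self (hz i), mul_one] at this

/-- Shifting one coordinate in the summand of the Jackson sum. -/
theorem jacksonTerm_update {q p : ℂ} (hq : q ≠ 0) {z : ι → ℂ} (hz : ∀ r, z r ≠ 0)
    (α : ι → ℂ) (d b : ℂ) (hb : ∀ r, ∀ l : ℕ, theta (b * z r * q ^ l) p ≠ 0) (m : ι → ℕ) (i : ι)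
    (h0 : ∏ s, theta (q ^ (-(Function.update m i (m i + 1) s : ℤ)) * (z i / z s)) p ≠ 0) :
    jacksonTerm q p α d b z (Function.update m i (m i + 1))
        * ((∏ s, theta (q ^ (-(Function.update m i (m i + 1) s : ℤ)) * (z i / z s)) p)
          / ∏ r, theta (b * z r * q ^ (Function.update m i (m i + 1) r)) p)
      = jacksonTerm q p α d (b * q) (Function.update z i (z i * q)) m
        * (((∏ j, theta (α j * z i) p) * theta (d * z i) p)
          / ((∏ r, theta (b * z r) p) * theta (b * q * z i) p)) := by
  have hB : ∏ r, theta (b * z r * q ^ (Function.update m i (m i + 1) r)) p ≠ 0 :=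
    Finset.prod_ne_zero_iff.2 fun r _ => hb r _
  -- Dividing by `∏ θ(b z_r q^{k_r})` is what replaces `b` by `bq` in the denominator row.
  have h1 := rowFac_mul_prod_theta q p b z (Function.update m i (m i + 1))
  rw [rowFac_update q p (b * q)] at h1
  unfold jacksonTerm
  rw [jacksonDenom_update hq hz, rowFac_update q p d]
  simp only [rowFac_update q p (α _)]
  rw [Finset.prod_mul_distrib]
  rw [div_mul_div_comm, div_mul_div_comm]
  generalize jacksonDenom q p (Function.update z i (z i * q)) m = D at *
  generalize (∏ s, theta (q ^ (-(Function.update m i (m i + 1) s : ℤ)) * (z i / z s)) p) = E at *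
  rw [show D * E * rowFac q p b z (Function.update m i (m i + 1))
      * ∏ r, theta (b * z r * q ^ (Function.update m i (m i + 1) r)) p
      = (D * (rowFac q p b z (Function.update m i (m i + 1))
      * ∏ r, theta (b * z r * q ^ (Function.update m i (m i + 1) r)) p)) * E by ring, h1,
    mul_div_mul_right _ _ h0]
  congr 1 <;> ring

/-- The partial fraction expansion that splits off one step of a multi-index. -/
theorem theta_partial_fraction_step {q p : ℂ} (hp : ‖p‖ < 1) (hq : q ≠ 0) {z : ι → ℂ}
    (hz : ∀ r, z r ≠ 0) {K : ℕ} (h : NonResonant q p z K) {b : ℂ} (hb0 : b ≠ 0)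
    (hb : ∀ r, ∀ l : ℕ, theta (b * z r * q ^ l) p ≠ 0) (k : ι → ℕ) :
    theta (q ^ (-((∑ r, k r : ℕ) : ℤ))) p
      = ∑ i, (∏ s, theta (q ^ (-(k s : ℤ)) * (z i / z s)) p)
          / (∏ r, theta (b * z r * q ^ k r) p)
        * ((∏ r, theta (b * z r) p) * theta (b * z i * q ^ (∑ r, k r)) p
          / (theta (b * z i) p * ∏ s ∈ Finset.univ.erase i, theta (z i / z s) p)) := by
  have hb' : ∀ r, theta (b * z r) p ≠ 0 := fun r => by simpa using hb r 0
  have ht : ∏ r, z r / (z r * q ^ k r) = q ^ (-((∑ r, k r : ℕ) : ℤ)) := by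
    rw [zpow_neg, zpow_natCast, ← Finset.prod_pow_eq_pow_sum, ← Finset.prod_inv_distrib]
    refine Finset.prod_congr rfl fun r _ => ?_
    have := hz r
    field_simp
  have pf := theta_partial_fraction_inv hp hz (b := fun r => z r * q ^ k r)
    (fun r => mul_ne_zero (hz r) (pow_ne_zero _ hq)) Finset.univ
    (fun r _ s _ hrs => h.ne_zero_of_ne hrs) hb0 (fun r _ => hb' r)
  rw [ht, Finset.prod_div_distrib] at pf
  have hB : ∏ r, theta (b * z r * q ^ k r) p ≠ 0 := Finset.prod_ne_zero_iff.2 fun r _ => hb r _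
  have hB' : ∏ r, theta (b * z r) p ≠ 0 := Finset.prod_ne_zero_iff.2 fun r _ => hb' r
  simp only [← mul_assoc b] at pf
  have hX : ((∏ r, theta (b * z r * q ^ k r) p) / ∏ r, theta (b * z r) p) ≠ 0 := div_ne_zero hB hB'
  rw [← eq_div_iff hX] at pf
  rw [pf, Finset.sum_div]
  refine Finset.sum_congr rfl fun i _ => ?_
  rw [zpow_neg, zpow_natCast, div_inv_eq_mul]
  have hs : ∀ s, z i / (z s * q ^ k s) = q ^ (-(k s : ℤ)) * (z i / z s) := fun s => by
    rw [zpow_neg, zpow_natCast]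
    field_simp
  simp only [hs]
  generalize ∏ s, theta (q ^ (-(k s : ℤ)) * (z i / z s)) p = F₁
  generalize theta (b * z i * q ^ ∑ r, k r) p = F₂
  field_simp

/-- The elliptic Jackson sum of type `A`, for generic `b`. -/
theorem elliptic_jackson_sum [Nonempty ι] {q p : ℂ} (hp : ‖p‖ < 1) (hq : q ≠ 0) {α : ι → ℂ}
    {d : ℂ} (hα : ∀ r, α r ≠ 0) (hd : d ≠ 0) (K : ℕ) : ∀ (z : ι → ℂ) (b : ℂ), (∀ r, z r ≠ 0) →
    NonResonant q p z K → b = d * (∏ j, α j) * ∏ j, z j →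
    (∀ r, ∀ l : ℕ, theta (b * z r * q ^ l) p ≠ 0) →
    ∑ k ∈ Finset.piAntidiag Finset.univ K, jacksonTerm q p α d b z k
      = (∏ j, thetaFac (b / α j) q p K) * thetaFac (b / d) q p K
        / (thetaFac (q ^ (-(K : ℤ))) q p K * rowFac q p b z fun _ => K) := by
  induction K with
  | zero =>
    intro z b hz hN hbd hb
    simp [jacksonTerm, rowFac, jacksonDenom, thetaFac_zero]
  | succ K ih =>
    intro z b hz hN hbd hb
    have hb0 : b ≠ 0 := by
      rw [hbd]
      exact mul_ne_zero (mul_ne_zero hd (Finset.prod_ne_zero_iff.2 fun j _ => hα j))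
        (Finset.prod_ne_zero_iff.2 fun j _ => hz j)
    have hb' : ∀ r, theta (b * z r) p ≠ 0 := fun r => by simpa using hb r 0
    have hB' : ∏ r, theta (b * z r) p ≠ 0 := Finset.prod_ne_zero_iff.2 fun r _ => hb' r
    obtain ⟨i₀⟩ := ‹Nonempty ι›
    have hQ := hN.theta_neg_ne_zero hz i₀
    -- The part of the `i`-th partial fraction coefficient that depends on `k` only through `|k| = K
    -- + 1`.
    set C : ι → ℂ := fun i => (∏ r, theta (b * z r) p) * theta (b * z i * q ^ (K + 1)) p
          / (theta (b * z i) p * ∏ s ∈ Finset.univ.erase i, theta (z i / z s) p) with hC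
    have ihi : ∀ i, ∑ m ∈ Finset.piAntidiag Finset.univ K,
        jacksonTerm q p α d (b * q) (Function.update z i (z i * q)) m
        = (∏ j, thetaFac (b * q / α j) q p K) * thetaFac (b * q / d) q p K
          / (thetaFac (q ^ (-(K : ℤ))) q p K
            * rowFac q p (b * q) (Function.update z i (z i * q)) fun _ => K) := by
      intro i
      refine ih _ _ (fun r => ?_) (hN.shift hq hz i) ?_ (fun r l => ?_)
      · by_cases hr : r = i
        · subst hr; simpa using ⟨hz r, hq⟩
        · simpa [hr] using hz r
      · rw [Finset.prod_update_of_mem (Finset.mem_univ i), Finset.sdiff_singleton_eq_erase, hbd,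
          ← Finset.mul_prod_erase _ z (Finset.mem_univ i)]
        ring
      · by_cases hr : r = i
        · subst hr
          have := hb r (l + 2)
          rwa [Function.update_self, show b * q * (z r * q) * q ^ l = b * z r * q ^ (l + 2) by ring]
        · have := hb r (l + 1)
          rwa [Function.update_of_ne hr, show b * q * z r * q ^ l = b * z r * q ^ (l + 1) by ring]
    -- When `k_i = 0` the factor with `s = i` is `θ(1) = 0`, so only multi-indices with `k_i ≥ 1`
    -- remain and the induction hypothesis at the shifted data applies.
    have step : ∀ i, ∑ k ∈ Finset.piAntidiag Finset.univ (K + 1), jacksonTerm q p α d b z k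
          * ((∏ s, theta (q ^ (-(k s : ℤ)) * (z i / z s)) p)
            / ∏ r, theta (b * z r * q ^ k r) p)
        = (∏ j, thetaFac (b * q / α j) q p K) * thetaFac (b * q / d) q p K
          / (thetaFac (q ^ (-(K : ℤ))) q p K
            * rowFac q p (b * q) (Function.update z i (z i * q)) fun _ => K)
          * (((∏ j, theta (α j * z i) p) * theta (d * z i) p)
            / ((∏ r, theta (b * z r) p) * theta (b * q * z i) p)) := by
      intro i
      rw [← ihi, Finset.sum_mul, sum_piAntidiag_succ i]
      · refine Finset.sum_congr rfl fun m hm => ?_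
        refine jacksonTerm_update hq hz α d b hb m i (Finset.prod_ne_zero_iff.2 fun s _ => ?_)
        have hle : ∀ s, m s ≤ K := fun s => by
          rw [← (Finset.mem_piAntidiag.1 hm).1]
          exact Finset.single_le_sum (fun _ _ => Nat.zero_le _) (Finset.mem_univ s)
        have := hle s
        by_cases hs : s = i
        · subst hs
          rw [Function.update_self]
          exact hN s s _ (by push_cast; omega) (by push_cast; omega) fun _ => by push_cast; omega
        · rw [Function.update_of_ne hs]
          exact hN i s _ (by push_cast; omega) (by push_cast; omega) fun e => absurd e.symm hs
      · intro k hk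
        rw [Finset.prod_eq_zero (Finset.mem_univ i), zero_div, mul_zero]
        rw [hk, div_self (hz i)]
        simpa using theta_one p hp
    have total : theta (q ^ (-((K + 1 : ℕ) : ℤ))) p
          * ∑ k ∈ Finset.piAntidiag Finset.univ (K + 1), jacksonTerm q p α d b z k
        = ∑ i, (∑ k ∈ Finset.piAntidiag Finset.univ (K + 1), jacksonTerm q p α d b z k
          * ((∏ s, theta (q ^ (-(k s : ℤ)) * (z i / z s)) p)
            / ∏ r, theta (b * z r * q ^ k r) p)) * C i := by
      simp only [Finset.sum_mul]
      rw [Finset.sum_comm, Finset.mul_sum]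
      refine Finset.sum_congr rfl fun k hk => ?_
      have hk := (Finset.mem_piAntidiag.1 hk).1
      have := theta_partial_fraction_step hp hq hz hN hb0 hb k
      rw [hk] at this
      rw [this, mul_comm, Finset.mul_sum]
      exact Finset.sum_congr rfl fun i _ => (mul_assoc _ _ _).symm
    -- Second expansion, with nodes `z_j` and numerator parameters `1/α_j`; the balancing condition
    -- makes `∏ z_j α_j = b/d`. It evaluates the remaining sum over `i`.
    have pf := theta_partial_fraction_inv hp hz (b := fun r => (α r)⁻¹)
      (fun r => inv_ne_zero (hα r)) Finset.univ
      (fun r _ s _ hrs => hN.ne_zero_of_ne hrs) hb0 (fun r _ => hb' r)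
    have ht : ∏ j, z j / (α j)⁻¹ = b / d := by
      simp only [div_inv_eq_mul, Finset.prod_mul_distrib]
      rw [hbd]
      field_simp
    rw [ht, Finset.prod_div_distrib] at pf
    simp only [div_inv_eq_mul, ← div_eq_mul_inv] at pf
    have hrow : ∀ i, (rowFac q p (b * q) (Function.update z i (z i * q)) fun _ => K)
          * ((∏ r, theta (b * z r) p) * theta (b * q * z i) p)
        = (rowFac q p b z fun _ => K + 1) * theta (b * z i * q ^ (K + 1)) p := by
      intro i
      have h1 := rowFac_const_update q p (b * q) z K i
      have h2 : (rowFac q p b z fun _ => K + 1)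
          = (∏ r, theta (b * z r) p) * rowFac q p (b * q) z fun _ => K := by
        unfold rowFac
        rw [← Finset.prod_mul_distrib]
        exact Finset.prod_congr rfl fun r _ => by rw [thetaFac_succ', mul_right_comm]
      rw [h2, show b * z i * q ^ (K + 1) = b * q * z i * q ^ K by ring]
      linear_combination (∏ r, theta (b * z r) p) * h1
    have hfacK : thetaFac (q ^ (-((K + 1 : ℕ) : ℤ))) q p (K + 1)
        = theta (q ^ (-((K + 1 : ℕ) : ℤ))) p * thetaFac (q ^ (-(K : ℤ))) q p K := by
      rw [thetaFac_succ', ← zpow_add_one₀ hq]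
      congr 3
      push_cast
      ring
    refine mul_left_cancel₀ hQ ?_
    rw [total]
    simp only [step]
    rw [hfacK]
    simp only [thetaFac_succ', Finset.prod_mul_distrib]
    set A₁ := ∏ j, thetaFac (b * q / α j) q p K
    set A₂ := thetaFac (b * q / d) q p K with hA₂
    set A₃ := thetaFac (q ^ (-(K : ℤ))) q p K
    have e1 : ∏ j, thetaFac (b / α j * q) q p K = A₁ :=
      Finset.prod_congr rfl fun j _ => by rw [div_mul_eq_mul_div]
    rw [e1, div_mul_eq_mul_div b d q, ← hA₂]
    have summand : ∀ i, A₁ * A₂ / (A₃ * rowFac q p (b * q) (Function.update z i (z i * q)) fun _ => K)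
          * (((∏ j, theta (α j * z i) p) * theta (d * z i) p)
            / ((∏ r, theta (b * z r) p) * theta (b * q * z i) p)) * C i
        = A₁ * A₂ / A₃ * (∏ r, theta (b * z r) p) / (rowFac q p b z fun _ => K + 1)
          * ((∏ j, theta (z i * α j) p) / (∏ s ∈ Finset.univ.erase i, theta (z i / z s) p)
            * (theta (b * z i / (b / d)) p / theta (b * z i) p)) := by
      intro i
      have hKi := hb i (K + 1)
      have e2 : b * z i / (b / d) = d * z i := by field_simp
      have e3 : ∏ j, theta (z i * α j) p = ∏ j, theta (α j * z i) p :=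
        Finset.prod_congr rfl fun j _ => by rw [mul_comm]
      rw [div_mul_div_comm, mul_assoc A₃, hrow, e2, e3]
      simp only [hC]
      generalize ∏ j, theta (α j * z i) p = F₁
      generalize theta (d * z i) p = F₂
      generalize theta (b * z i * q ^ (K + 1)) p = F₃ at *
      field_simp
    simp only [summand]
    rw [← Finset.mul_sum, ← pf]
    field_simp

/-! ### Reversal of factorials and passage to the Vandermonde form. -/

theorem thetaFac_add (a q p : ℂ) (k l : ℕ) :
    thetaFac a q p (k + l) = thetaFac a q p k * thetaFac (a * q ^ k) q p l := by
  unfold thetaFac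
  rw [Finset.prod_range_add]
  congr 1
  exact Finset.prod_congr rfl fun j _ => by rw [pow_add, mul_assoc]

theorem thetaFac_ne_zero_of_le {a q p : ℂ} {k N : ℕ} (h : thetaFac a q p N ≠ 0) (hk : k ≤ N) :
    thetaFac a q p k ≠ 0 := by
  obtain ⟨l, rfl⟩ := Nat.exists_eq_add_of_le hk
  rw [thetaFac_add] at h
  exact left_ne_zero_of_mul h

theorem theta_ne_zero_of_thetaFac {a q p : ℂ} {k N : ℕ} (h : thetaFac a q p N ≠ 0) (hk : k < N) :
    theta (a * q ^ k) p ≠ 0 := Finset.prod_ne_zero_iff.1 h k (Finset.mem_range.2 hk)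

/-- Reversal of the factors of a theta shifted factorial. -/
theorem thetaFac_reflect {p q w : ℂ} (hp : ‖p‖ < 1) (hq : q ≠ 0) (hw : w ≠ 0) (l : ℕ) :
    thetaFac (q ^ (1 - (l : ℤ)) * w⁻¹) q p l
      = (-w⁻¹) ^ l * (q ^ (l.choose 2))⁻¹ * thetaFac w q p l := by
  have h : thetaFac (q ^ (1 - (l : ℤ)) * w⁻¹) q p l
      = ∏ j ∈ Finset.range l, theta ((w * q ^ j)⁻¹) p := by
    unfold thetaFac
    rw [← Finset.prod_range_reflect]
    refine Finset.prod_congr rfl fun j hj => ?_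
    have hj := Finset.mem_range.1 hj
    congr 1
    rw [mul_inv, mul_right_comm, ← zpow_natCast, ← zpow_add₀ hq, ← zpow_natCast q j, ← zpow_neg,
      mul_comm]
    congr 2
    omega
  rw [h]
  clear h
  induction l with
  | zero => simp [thetaFac_zero]
  | succ l ih =>
    rw [Finset.prod_range_succ, ih, thetaFac_succ,
      theta_inv hp (mul_ne_zero hw (pow_ne_zero l hq)), Nat.choose_succ_succ' l 1,
      Nat.choose_one_right, pow_add q, pow_succ (-w⁻¹), mul_inv, mul_inv]
    ring

/-- The factor `(-1)^k q^{-k(k+1)/2}` relating `(q; q, p)_k` and `(q^{-k}; q, p)_k`. -/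
noncomputable def reflectFactor (q : ℂ) (k : ℕ) : ℂ := (-q⁻¹) ^ k * (q ^ (k.choose 2))⁻¹

theorem reflectFactor_ne_zero {q : ℂ} (hq : q ≠ 0) (k : ℕ) : reflectFactor q k ≠ 0 :=
  mul_ne_zero (pow_ne_zero _ (neg_ne_zero.2 (inv_ne_zero hq))) (inv_ne_zero (pow_ne_zero _ hq))

theorem thetaFac_neg {p q : ℂ} (hp : ‖p‖ < 1) (hq : q ≠ 0) (k : ℕ) :
    thetaFac (q ^ (-(k : ℤ))) q p k = reflectFactor q k * thetaFac q q p k := by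
  have := thetaFac_reflect hp hq hq k
  rwa [← zpow_neg_one, ← zpow_add₀ hq, show 1 - (k : ℤ) + -1 = -k by ring, zpow_neg_one] at this

theorem reflectFactor_add (q : ℂ) (k l : ℕ) :
    reflectFactor q (k + l) = reflectFactor q k * reflectFactor q l * (q ^ (k * l))⁻¹ := by
  have h : (k + l).choose 2 = k.choose 2 + l.choose 2 + k * l := by
    induction l with
    | zero => simp
    | succ l ih =>
      rw [← add_assoc, Nat.choose_succ_succ' (k + l) 1, Nat.choose_succ_succ' l 1,
        Nat.choose_one_right, Nat.choose_one_right, ih]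
      ring
  unfold reflectFactor
  rw [h, pow_add, pow_add, pow_add, mul_inv, mul_inv]
  ring

/-- The binomial `choose 2` of a sum is the sum of the binomials plus all products `k_r k_s` with `r
< s`. -/
theorem prod_reflectFactor (q : ℂ) : ∀ {n : ℕ} (k : Fin n → ℕ),
    (∏ r, reflectFactor q (k r)) * ∏ r, ∏ s ∈ Finset.Ioi r, (q ^ (k r * k s))⁻¹
      = reflectFactor q (∑ r, k r)
  | 0, _ => by simp [reflectFactor]
  | n + 1, k => by
    rw [Fin.sum_univ_succ, reflectFactor_add, ← prod_reflectFactor q fun r : Fin n => k r.succ,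
      Fin.prod_univ_succ, Fin.prod_univ_succ (fun r => ∏ s ∈ Finset.Ioi r, _),
      Fin.prod_Ioi_zero, Finset.mul_sum, ← Finset.prod_pow_eq_pow_sum, ← Finset.prod_inv_distrib]
    simp only [Fin.prod_Ioi_succ]
    ring

theorem prod_pow_Ioi (q : ℂ) : ∀ {n : ℕ} (k : Fin n → ℕ),
    ∏ r, ∏ s ∈ Finset.Ioi r, q ^ k s = q ^ (∑ r : Fin n, (r : ℕ) * k r)
  | 0, _ => by simp
  | n + 1, k => by
    rw [Fin.prod_univ_succ, Fin.prod_Ioi_zero, Fin.sum_univ_succ]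
    simp only [Fin.prod_Ioi_succ]
    rw [prod_pow_Ioi q fun r : Fin n => k r.succ, Finset.prod_pow_eq_pow_sum, ← pow_add,
      ← Finset.sum_add_distrib]
    congr 1
    simp only [Fin.val_zero, zero_mul, zero_add, Fin.val_succ]
    exact Finset.sum_congr rfl fun r _ => by ring

/-- Split `(q^{-l} y; q, p)_{k+l+1}` in two ways, isolating `θ(q^{k-l} y)` after `k` factors or
`θ(y)` after `l` factors, and reverse the remaining blocks of length `l`. -/
theorem thetaFac_pair {p q y : ℂ} (hp : ‖p‖ < 1) (hq : q ≠ 0) (hy : y ≠ 0) (k l : ℕ) :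
    theta (q ^ ((k : ℤ) - (l : ℤ)) * y) p
        * (thetaFac (q ^ (-(l : ℤ)) * y) q p k * thetaFac (q ^ (-(k : ℤ)) * y⁻¹) q p l)
      = (q ^ (k * l))⁻¹ * (q ^ l)⁻¹ * theta y p
        * (thetaFac (q * y) q p k * thetaFac (q * y⁻¹) q p l) := by
  have h1 := thetaFac_reflect hp hq (w := q ^ (1 - (l : ℤ) + k) * y)
    (mul_ne_zero (zpow_ne_zero _ hq) hy) l
  have h2 := thetaFac_reflect hp hq (w := q ^ (-(l : ℤ)) * y)
    (mul_ne_zero (zpow_ne_zero _ hq) hy) l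
  rw [mul_inv, ← mul_assoc, ← zpow_neg, ← zpow_add₀ hq,
    show 1 - (l : ℤ) + -(1 - (l : ℤ) + k) = -k by ring] at h1
  rw [mul_inv, ← mul_assoc, ← zpow_neg, ← zpow_add₀ hq,
    show 1 - (l : ℤ) + -(-(l : ℤ)) = 1 by ring, zpow_one] at h2
  have e1 : thetaFac (q ^ (-(l : ℤ)) * y) q p (k + (1 + l))
      = thetaFac (q ^ (-(l : ℤ)) * y) q p k * (theta (q ^ ((k : ℤ) - (l : ℤ)) * y) p
        * thetaFac (q ^ (1 - (l : ℤ) + k) * y) q p l) := by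
    rw [thetaFac_add, add_comm 1 l, thetaFac_succ']
    have a1 : q ^ (-(l : ℤ)) * y * q ^ k = q ^ ((k : ℤ) - (l : ℤ)) * y := by
      rw [mul_right_comm, ← zpow_natCast q k, ← zpow_add₀ hq]; congr 2; ring
    have a2 : q ^ ((k : ℤ) - (l : ℤ)) * y * q = q ^ (1 - (l : ℤ) + k) * y := by
      rw [mul_right_comm, ← zpow_add_one₀ hq]; congr 2; ring
    rw [a1, a2]
  have e2 : thetaFac (q ^ (-(l : ℤ)) * y) q p (l + (1 + k))
      = thetaFac (q ^ (-(l : ℤ)) * y) q p l * (theta y p * thetaFac (q * y) q p k) := by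
    rw [thetaFac_add, add_comm 1 k, thetaFac_succ']
    have a1 : q ^ (-(l : ℤ)) * y * q ^ l = y := by
      rw [zpow_neg, zpow_natCast]; field_simp
    rw [a1, mul_comm y q]
  have e3 := e1.symm.trans ((congrArg _ (by ring)).trans e2)
  have e4 : (-(q ^ (-(1 - (l : ℤ) + k)) * y⁻¹)) ^ l
      = (q ^ (k * l))⁻¹ * (q ^ l)⁻¹ * (-(q ^ (-(-(l : ℤ))) * y⁻¹)) ^ l := by
    have : q ^ (-(1 - (l : ℤ) + k)) = (q ^ k)⁻¹ * q⁻¹ * q ^ (-(-(l : ℤ))) := by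
      rw [← zpow_natCast q k, ← zpow_neg, ← zpow_neg_one, ← zpow_add₀ hq, ← zpow_add₀ hq]
      congr 1; ring
    rw [this, pow_mul]
    generalize q ^ (-(-(l : ℤ))) = u
    rw [show -((q ^ k)⁻¹ * q⁻¹ * u * y⁻¹) = (q ^ k)⁻¹ * q⁻¹ * -(u * y⁻¹) by ring, mul_pow, mul_pow,
      inv_pow, inv_pow]
  rw [h1, h2, e4]
  linear_combination ((q ^ (k * l))⁻¹ * (q ^ l)⁻¹ * (-(q ^ (-(-(l : ℤ))) * y⁻¹)) ^ l
    * (q ^ (l.choose 2))⁻¹) * e3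

theorem prod_prod_eq_diag_mul {n : ℕ} (g : Fin n → Fin n → ℂ) :
    ∏ r, ∏ s, g r s = (∏ r, g r r) * ∏ r, ∏ s ∈ Finset.Ioi r, g r s * g s r := by
  have h := Finset.prod_prod_Ioi_mul_eq_prod_prod_off_diag fun r s => g s r
  rw [h, ← Finset.prod_mul_distrib]
  refine Finset.prod_congr rfl fun r _ => ?_
  rw [← Fintype.prod_eq_mul_prod_compl]

/-- Off-diagonal factors are matched in pairs `(r, s)`, `(s, r)` by `thetaFac_pair`, diagonal ones
by `thetaFac_neg`. The leftover powers of `q` combine into a factor depending only on `|k|`. -/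
theorem ellipticVandermonde_mul_jacksonDenom {p q : ℂ} (hp : ‖p‖ < 1) (hq : q ≠ 0) {n : ℕ}
    {x : Fin n → ℂ} (hx : ∀ r, x r ≠ 0) (hV : ∀ r s, r < s → theta (x r / x s) p ≠ 0)
    (k : Fin n → ℕ) :
    ellipticVandermonde q p x k * q ^ (∑ r : Fin n, (r : ℕ) * k r) * jacksonDenom q p x k
      = reflectFactor q (∑ r, k r) * ∏ r, ∏ s, thetaFac (q * (x r / x s)) q p (k r) := by
  have hpair : ∀ r, ∀ s ∈ Finset.Ioi r,
      theta (q ^ ((k r : ℤ) - (k s : ℤ)) * (x r / x s)) p / theta (x r / x s) p * q ^ k s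
        * (thetaFac (q ^ (-(k s : ℤ)) * (x r / x s)) q p (k r)
          * thetaFac (q ^ (-(k r : ℤ)) * (x s / x r)) q p (k s))
      = (q ^ (k r * k s))⁻¹ * (thetaFac (q * (x r / x s)) q p (k r)
          * thetaFac (q * (x s / x r)) q p (k s)) := by
    intro r s hs
    have h := thetaFac_pair hp hq (div_ne_zero (hx r) (hx s)) (k r) (k s)
    have h0 := hV r s (Finset.mem_Ioi.1 hs)
    have hqk : q ^ k s ≠ 0 := pow_ne_zero _ hq
    rw [inv_div] at h
    rw [div_mul_eq_mul_div, div_mul_eq_mul_div, div_eq_iff h0]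
    have hc : (q ^ k s)⁻¹ * q ^ k s = 1 := inv_mul_cancel₀ hqk
    linear_combination q ^ k s * h + (q ^ (k r * k s))⁻¹ * theta (x r / x s) p
        * (thetaFac (q * (x r / x s)) q p (k r) * thetaFac (q * (x s / x r)) q p (k s)) * hc
  have hdiag : ∏ r, thetaFac (q ^ (-(k r : ℤ)) * (x r / x r)) q p (k r)
      = (∏ r, reflectFactor q (k r)) * ∏ r, thetaFac (q * (x r / x r)) q p (k r) := by
    rw [← Finset.prod_mul_distrib]
    refine Finset.prod_congr rfl fun r _ => ?_
    rw [div_self (hx r), mul_one, mul_one, thetaFac_neg hp hq]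
  unfold jacksonDenom
  rw [prod_prod_eq_diag_mul, prod_prod_eq_diag_mul, ← prod_pow_Ioi, ← prod_reflectFactor, hdiag,
    ellipticVandermonde]
  have := Finset.prod_congr rfl fun r (_ : r ∈ Finset.univ) => Finset.prod_congr rfl (hpair r)
  simp only [Finset.prod_mul_distrib] at this ⊢
  linear_combination (∏ r, reflectFactor q (k r))
    * (∏ r, thetaFac (q * (x r / x r)) q p (k r)) * this

theorem nonResonant_of_thetaFac_ne_zero {p q : ℂ} (hp : ‖p‖ < 1) (hq : q ≠ 0) {n : ℕ}
    {x : Fin n → ℂ} (hx : ∀ r, x r ≠ 0) (hV : ∀ r s, r < s → theta (x r / x s) p ≠ 0) {N : ℕ}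
    (hQ : ∀ r s, thetaFac (q * (x r / x s)) q p N ≠ 0) : NonResonant q p x N := by
  have hinv : ∀ (r s : Fin n) (j : ℤ), theta (q ^ (-j) * (x s / x r)) p ≠ 0 →
      theta (q ^ j * (x r / x s)) p ≠ 0 := by
    intro r s j h
    have h0 : q ^ (-j) * (x s / x r) ≠ 0 :=
      mul_ne_zero (zpow_ne_zero _ hq) (div_ne_zero (hx s) (hx r))
    have := theta_inv hp h0
    rw [mul_inv, ← zpow_neg, neg_neg, inv_div] at this
    rw [this]
    exact mul_ne_zero (neg_ne_zero.2
      (mul_ne_zero (zpow_ne_zero _ hq) (div_ne_zero (hx r) (hx s)))) h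
  have hpos : ∀ (r s : Fin n) (j : ℤ), 0 < j → j ≤ N → theta (q ^ j * (x r / x s)) p ≠ 0 := by
    intro r s j h1 h2
    obtain ⟨m, rfl⟩ : ∃ m : ℕ, j = m + 1 := ⟨(j - 1).toNat, by omega⟩
    have := theta_ne_zero_of_thetaFac (hQ r s) (k := m) (by omega)
    rwa [show q ^ ((m : ℤ) + 1) * (x r / x s) = q * (x r / x s) * q ^ m by
      rw [zpow_add_one₀ hq, zpow_natCast]; ring]
  intro r s j h1 h2 h3
  rcases lt_trichotomy j 0 with hj | hj | hj
  · exact hinv r s j (hpos s r (-j) (by omega) (by omega))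
  · subst hj
    rcases lt_trichotomy r s with hrs | hrs | hrs
    · simpa using hV r s hrs
    · exact absurd rfl (h3 hrs)
    · exact hinv r s 0 (by simpa using hV s r hrs)
  · exact hpos r s j hj h2

theorem NonResonant.mono {ι : Type*} {q p : ℂ} {z : ι → ℂ} {K N : ℕ} (h : NonResonant q p z N)
    (hK : K ≤ N) : NonResonant q p z K :=
  fun r s j h1 h2 h3 => h r s j (by omega) (by omega) h3

/-! ### Specialisation, continuity in `b`, and summation over the layers. -/

theorem continuousAt_thetaFac_mul {p q : ℂ} (hp : ‖p‖ < 1) (hq : q ≠ 0) {b c : ℂ}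
    (hb : p ≠ 0 → b ≠ 0) (hc : c ≠ 0) (k : ℕ) :
    ContinuousAt (fun b => thetaFac (b * c) q p k) b :=
  tendsto_finsetProd _ fun j _ =>
    ContinuousAt.comp (g := fun a => theta a p) (f := fun b => b * c * q ^ j)
      (continuousAt_theta hp fun h => mul_ne_zero (mul_ne_zero (hb h) hc) (pow_ne_zero _ hq))
      (by fun_prop)

theorem sum_multiIndicesLE {n N : ℕ} (g : (Fin n → ℕ) → ℂ) :
    ∑ k ∈ multiIndicesLE n N, g k
      = ∑ K ∈ Finset.range (N + 1), ∑ k ∈ Finset.piAntidiag Finset.univ K, g k := by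
  have hmaps : ∀ k ∈ multiIndicesLE n N, ∑ r, k r ∈ Finset.range (N + 1) := fun k hk =>
    Finset.mem_range.2 (Nat.lt_succ_of_le (mem_multiIndicesLE.1 hk))
  rw [← Finset.sum_fiberwise_of_maps_to hmaps]
  refine Finset.sum_congr rfl fun K hK => Finset.sum_congr ?_ fun _ _ => rfl
  ext k
  have := Finset.mem_range.1 hK
  simp only [Finset.mem_filter, mem_multiIndicesLE, Finset.mem_piAntidiag, Finset.mem_univ,
    implies_true, and_true]
  exact ⟨fun h => h.2, fun h => ⟨(le_of_eq h).trans (by omega), h⟩⟩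

/-- The part of the multiple sum with `|k| = K`. -/
theorem sum_piAntidiag_eq {n : ℕ} (hn : 1 ≤ n) {K : ℕ} {p q b : ℂ} {a x : Fin n → ℂ}
    (hp : ‖p‖ < 1) (hq : q ≠ 0) (hb : p ≠ 0 → b ≠ 0)
    (ha : ∀ r, a r ≠ 0) (hx : ∀ r, x r ≠ 0)
    (hV : ∀ r s, r < s → theta (x r / x s) p ≠ 0)
    (hQ : ∀ r s, thetaFac (q * (x r / x s)) q p K ≠ 0)
    (hB : ∀ r, thetaFac (b * x r) q p K ≠ 0)
    (hBA : ∀ r, thetaFac (b * x r / a r) q p K ≠ 0) :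
    ∑ k ∈ Finset.piAntidiag Finset.univ K,
        (ellipticVandermonde q p x k
          * (∏ r, ∏ s, thetaFac (a s * (x r / x s)) q p (k r)
                / thetaFac (q * (x r / x s)) q p (k r))
          * (∏ r, thetaFac (b * x r / ∏ s, a s) q p (k r) * thetaFac (b * x r) q p K
                / (thetaFac (b * x r) q p (k r) * thetaFac (b * x r / a r) q p K))
          * q ^ (∑ r : Fin n, (r : ℕ) * k r))
      = thetaFac (∏ s, a s) q p K / thetaFac q q p K := by
  have : Nonempty (Fin n) := ⟨⟨0, hn⟩⟩
  have hN := nonResonant_of_thetaFac_ne_zero hp hq hx hV hQ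
  have hA : ∏ s, a s ≠ 0 := Finset.prod_ne_zero_iff.2 fun s _ => ha s
  have hX : ∏ s, x s ≠ 0 := Finset.prod_ne_zero_iff.2 fun s _ => hx s
  have hle : ∀ k ∈ Finset.piAntidiag (Finset.univ : Finset (Fin n)) K, ∀ r, k r ≤ K := by
    intro k hk r
    rw [← (Finset.mem_piAntidiag.1 hk).1]
    exact Finset.single_le_sum (fun _ _ => Nat.zero_le _) (Finset.mem_univ r)
  -- The Jackson sum needs `b ≠ 0` and `θ(b x_r q^l) ≠ 0` for every `l`, more than is assumed. These
  -- conditions, and the analogue with `x_r/a_r`, hold off this countable set, while the right side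
  -- is constant in `b`.
  let S : Set ℂ := {0} ∪ ⋃ (r : Fin n) (l : ℕ), ((fun c => x r * q ^ l * c) ⁻¹' {c | theta c p = 0}
    ∪ (fun c => x r / a r * q ^ l * c) ⁻¹' {c | theta c p = 0})
  have hS : S.Countable := by
    refine (Set.countable_singleton 0).union (Set.countable_iUnion fun r =>
      Set.countable_iUnion fun l => ?_)
    exact ((countable_theta_zeros hp).preimage (mul_right_injective₀
      (mul_ne_zero (hx r) (pow_ne_zero _ hq)))).union ((countable_theta_zeros hp).preimage
      (mul_right_injective₀ (mul_ne_zero (div_ne_zero (hx r) (ha r)) (pow_ne_zero _ hq))))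
  refine eq_of_eqOn_compl_countable (s := b)
    (F := fun b => ∑ k ∈ Finset.piAntidiag Finset.univ K,
        (ellipticVandermonde q p x k
          * (∏ r, ∏ s, thetaFac (a s * (x r / x s)) q p (k r)
                / thetaFac (q * (x r / x s)) q p (k r))
          * (∏ r, thetaFac (b * x r / ∏ s, a s) q p (k r) * thetaFac (b * x r) q p K
                / (thetaFac (b * x r) q p (k r) * thetaFac (b * x r / a r) q p K))
          * q ^ (∑ r : Fin n, (r : ℕ) * k r)))
    (G := fun _ => thetaFac (∏ s, a s) q p K / thetaFac q q p K) hS ?_ continuousAt_const ?_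
  · refine tendsto_finsetSum _ fun k hk => ContinuousAt.mul (ContinuousAt.mul continuousAt_const
      (tendsto_finsetProd _ fun r _ => ?_)) continuousAt_const
    simp only [mul_div_assoc _ (x r)]
    refine ContinuousAt.div (ContinuousAt.mul ?_ ?_) (ContinuousAt.mul ?_ ?_) (mul_ne_zero ?_ ?_)
    · exact continuousAt_thetaFac_mul hp hq hb (div_ne_zero (hx r) hA) _
    · exact continuousAt_thetaFac_mul hp hq hb (hx r) _
    · exact continuousAt_thetaFac_mul hp hq hb (hx r) _
    · exact continuousAt_thetaFac_mul hp hq hb (div_ne_zero (hx r) (ha r)) _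
    · exact thetaFac_ne_zero_of_le (hB r) (hle k hk r)
    · rw [← mul_div_assoc]; exact hBA r
  · intro c hc
    simp only [S, Set.mem_union, Set.mem_singleton_iff, Set.mem_iUnion, Set.mem_preimage,
      Set.mem_ofPred_eq, not_or, not_exists] at hc
    obtain ⟨hc0, hc⟩ := hc
    have hcx : ∀ r, ∀ l : ℕ, theta (c * x r * q ^ l) p ≠ 0 := fun r l => by
      have := (hc r l).1
      rwa [show x r * q ^ l * c = c * x r * q ^ l by ring] at this
    have hcF : ∀ r k, thetaFac (c * x r) q p k ≠ 0 := fun r k =>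
      Finset.prod_ne_zero_iff.2 fun l _ => hcx r l
    have hcA : ∀ r, thetaFac (c * x r / a r) q p K ≠ 0 := fun r =>
      Finset.prod_ne_zero_iff.2 fun l _ => by
        have := (hc r l).2
        rwa [show x r / a r * q ^ l * c = c * x r / a r * q ^ l by ring] at this
    -- With `α_r = a_r/x_r` and `d = c/∏ a_s` the balancing condition is automatic, and `c/d = ∏
    -- a_s` yields the numerator of the answer.
    have J := elliptic_jackson_sum hp hq (α := fun r => a r / x r) (d := c / ∏ s, a s)
      (fun r => div_ne_zero (ha r) (hx r)) (div_ne_zero hc0 hA) K x c hx hN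
      (by rw [Finset.prod_div_distrib]; field_simp) hcx
    have hterm : ∀ k ∈ Finset.piAntidiag (Finset.univ : Finset (Fin n)) K,
        ellipticVandermonde q p x k
          * (∏ r, ∏ s, thetaFac (a s * (x r / x s)) q p (k r)
                / thetaFac (q * (x r / x s)) q p (k r))
          * (∏ r, thetaFac (c * x r / ∏ s, a s) q p (k r) * thetaFac (c * x r) q p K
                / (thetaFac (c * x r) q p (k r) * thetaFac (c * x r / a r) q p K))
          * q ^ (∑ r : Fin n, (r : ℕ) * k r)
        = jacksonTerm q p (fun r => a r / x r) (c / ∏ s, a s) c x k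
          * (reflectFactor q K * (rowFac q p c x fun _ => K)
            / ∏ r, thetaFac (c * x r / a r) q p K) := by
      intro k hk
      have hkK : ∑ r, k r = K := (Finset.mem_piAntidiag.1 hk).1
      have h1 := ellipticVandermonde_mul_jacksonDenom hp hq hx hV k
      rw [hkK] at h1
      have hD : jacksonDenom q p x k ≠ 0 := by
        refine Finset.prod_ne_zero_iff.2 fun r _ => Finset.prod_ne_zero_iff.2 fun s _ =>
          Finset.prod_ne_zero_iff.2 fun j hj => ?_
        have hj := Finset.mem_range.1 hj
        have h2 := hle k hk r
        have h3 := hle k hk s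
        have := hN r s (-(k s : ℤ) + j) (by omega) (by omega) fun e => by subst e; omega
        rwa [zpow_add₀ hq, zpow_natCast, mul_right_comm] at this
      have hQQ : ∏ r, ∏ s, thetaFac (q * (x r / x s)) q p (k r) ≠ 0 :=
        Finset.prod_ne_zero_iff.2 fun r _ => Finset.prod_ne_zero_iff.2 fun s _ =>
          thetaFac_ne_zero_of_le (hQ r s) (hle k hk r)
      have hrow : ∏ j, rowFac q p (a j / x j) x k
          = ∏ r, ∏ s, thetaFac (a s * (x r / x s)) q p (k r) := by
        unfold rowFac
        rw [Finset.prod_comm]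
        refine Finset.prod_congr rfl fun r _ => Finset.prod_congr rfl fun s _ => ?_
        rw [show a s / x s * x r = a s * (x r / x s) by ring]
      have hrowd : rowFac q p (c / ∏ s, a s) x k
          = ∏ r, thetaFac (c * x r / ∏ s, a s) q p (k r) :=
        Finset.prod_congr rfl fun r _ => by rw [div_mul_eq_mul_div]
      have hR : rowFac q p c x k ≠ 0 := Finset.prod_ne_zero_iff.2 fun r _ => hcF r _
      have hP : ∏ r, thetaFac (c * x r / a r) q p K ≠ 0 :=
        Finset.prod_ne_zero_iff.2 fun r _ => hcA r
      unfold jacksonTerm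
      rw [hrow, hrowd]
      simp only [Finset.prod_div_distrib, Finset.prod_mul_distrib]
      change _ * _ * ((_ * rowFac q p c x fun _ => K) / (rowFac q p c x k * _)) * _ = _
      rw [div_mul_div_comm, mul_div_assoc', mul_div_assoc', div_mul_eq_mul_div,
        div_mul_eq_mul_div, div_mul_eq_mul_div, div_div, div_eq_div_iff (mul_ne_zero hQQ (mul_ne_zero hR hP))
          (mul_ne_zero (mul_ne_zero hD hR) hP)]
      linear_combination ((∏ r, ∏ s, thetaFac (a s * (x r / x s)) q p (k r))
        * (∏ r, thetaFac (c * x r / ∏ s, a s) q p (k r)) * (rowFac q p c x fun _ => K)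
        * rowFac q p c x k * ∏ r, thetaFac (c * x r / a r) q p K) * h1
    have hP : ∏ r, thetaFac (c * x r / a r) q p K ≠ 0 :=
      Finset.prod_ne_zero_iff.2 fun r _ => hcA r
    have hR : (rowFac q p c x fun _ => K) ≠ 0 := Finset.prod_ne_zero_iff.2 fun r _ => hcF r _
    have hq0 : thetaFac q q p K ≠ 0 := by
      have := hQ ⟨0, hn⟩ ⟨0, hn⟩
      rwa [div_self (hx _), mul_one] at this
    have hα : ∏ j, thetaFac (c / (a j / x j)) q p K = ∏ r, thetaFac (c * x r / a r) q p K :=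
      Finset.prod_congr rfl fun j _ => by rw [div_div_eq_mul_div]
    have hr := reflectFactor_ne_zero hq K
    rw [Finset.sum_congr rfl hterm, ← Finset.sum_mul, J, hα, thetaFac_neg hp hq,
      show c / (c / ∏ s, a s) = ∏ s, a s by field_simp]
    generalize thetaFac (∏ s, a s) q p K = A
    field_simp

end EllipticSeries

theorem mainTheorem6
    (n : ℕ) (hn : 1 ≤ n) (N : ℕ) (f : ℕ → ℂ)
    (p q b : ℂ) (a x : Fin n → ℂ)
    (hp : ‖p‖ < 1) (hq : q ≠ 0) (hb : p ≠ 0 → b ≠ 0)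
    (ha : ∀ r, a r ≠ 0) (hx : ∀ r, x r ≠ 0)
    -- no denominator vanishes
    (hV : ∀ r s, r < s → EllipticSeries.theta (x r / x s) p ≠ 0)
    (hQ : ∀ r s, EllipticSeries.thetaFac (q * (x r / x s)) q p N ≠ 0)
    (hB : ∀ r, EllipticSeries.thetaFac (b * x r) q p N ≠ 0)
    (hBA : ∀ r, EllipticSeries.thetaFac (b * x r / a r) q p N ≠ 0) :
    ∑ k ∈ EllipticSeries.multiIndicesLE n N,
        (EllipticSeries.ellipticVandermonde q p x k
          * (∏ r, ∏ s,
              EllipticSeries.thetaFac (a s * (x r / x s)) q p (k r)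
                / EllipticSeries.thetaFac (q * (x r / x s)) q p (k r))
          * (∏ r,
              EllipticSeries.thetaFac (b * x r / ∏ s, a s) q p (k r)
                  * EllipticSeries.thetaFac (b * x r) q p (∑ s, k s)
                / (EllipticSeries.thetaFac (b * x r) q p (k r)
                  * EllipticSeries.thetaFac (b * x r / a r) q p (∑ s, k s)))
          * q ^ (∑ r : Fin n, (r : ℕ) * k r)
          * f (∑ s, k s))
      = ∑ K ∈ Finset.range (N + 1),
          EllipticSeries.thetaFac (∏ s, a s) q p K / EllipticSeries.thetaFac q q p K * f K := by
  rw [EllipticSeries.sum_multiIndicesLE]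
  refine Finset.sum_congr rfl fun K hK => ?_
  have hKN : K ≤ N := Nat.lt_succ_iff.1 (Finset.mem_range.1 hK)
  rw [← EllipticSeries.sum_piAntidiag_eq hn hp hq hb ha hx hV
    (fun r s => EllipticSeries.thetaFac_ne_zero_of_le (hQ r s) hKN)
    (fun r => EllipticSeries.thetaFac_ne_zero_of_le (hB r) hKN)
    (fun r => EllipticSeries.thetaFac_ne_zero_of_le (hBA r) hKN), Finset.sum_mul]
  refine Finset.sum_congr rfl fun k hk => ?_
  rw [(Finset.mem_piAntidiag.1 hk).1]
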